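/- Let $T=V/\Lambda$ be a complex torus of dimension $g\ge 3$, where $V$ is a $g$-dimensional complex vector space and $\Lambda\subset V$ is a lattice of rank $2g$. Let $\mathrm{End}(T)$ be the endomorphism ring of the complex Lie group $T$, $\mathrm{End}^0(T)=\mathrm{End}(T)\otimes\mathbb{Q}$, and $\mathrm{Aut}(T)=\mathrm{End}(T)^*$ the automorphism group of the complex Lie group $T$. Suppose that $T$ is $2$-simple, i.e., for every rational Hodge substructure $H$ of $H^2(T,\mathbb{Q})$ such that $H_{\mathbb{C}}=H\otimes_{\mathbb{Q}}\mathbb{C}$ meets $H^{2,0}(T)$ in a nonzero subspace, $H_{\mathbb{C}}$ contains the whole $H^{2,0}(T)$. A number field $E$ is called primitive if $E=\mathbb{Q}$ or the only proper subfield of $E$ is $\mathbb{Q}$; $r_E$ and $s_E$ denote the number of real embeddings and of pairs of complex conjugate non-real embeddings of $E$. Then: (i) $T$ is simple, i.e., it has no complex subtori except $0$ and $T$. (ii) Every subfield of $\mathrm{End}^0(T)$ is a number field whose degree over $\mathbb{Q}$ is $1$, $g$ or $2g$. (iii) $\mathrm{End}^0(T)$ is a number field whose degree over $\mathbb{Q}$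 is $1$, $g$ or $2g$. (iv) If $[\mathrm{End}^0(T):\mathbb{Q}]=1$, then $\mathrm{End}^0(T)=\mathbb{Q}$, $\mathrm{End}(T)=\mathbb{Z}$ and $\mathrm{Aut}(T)=\{\pm1\}$. (v) If $E=\mathrm{End}^0(T)$ has degree $2g$ over $\mathbb{Q}$, then $E$ is purely imaginary (it has no real embeddings) and $\mathrm{Aut}(T)\cong\{\pm1\}\times\mathbb{Z}^{g-1}$. In addition, if $E$ is not primitive, then it contains precisely one proper subfield other than $\mathbb{Q}$, and this subfield has degree $g$ over $\mathbb{Q}$. (vi) If $E=\mathrm{End}^0(T)$ has degree $g$ over $\mathbb{Q}$, then $E$ is primitive and $\mathrm{Aut}(T)\cong\mathbb{Z}^d\times\{\pm1\}$, where the positive integer $d$ equals $r_E+s_E-1$; in particular, $\frac12\le\frac g2-1\le d\le g-1$. In addition, if $T$ is a complex abelian variety, then $E$ is a primitive totally real number field and $d=g-1$. -/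

import Mathlib

open scoped TensorProduct Topology

universe u v

/-!
A complex torus is `T = V ⧸ Λ`, where `V` is a finite-dimensional complex vector space and `Λ` is a
discrete subgroup of `V` that spans `V` over `ℝ` (`[DiscreteTopology Λ] [IsZLattice ℝ Λ]`).
-/
namespace ComplexTorus

section Endomorphisms

variable {V : Type u} [NormedAddCommGroup V] [NormedSpace ℂ V]

/-- An additive map `φ : T → T` is holomorphic: since the projection `V → T` is a local
biholomorphism, this means that near every point `φ` lifts to a holomorphic map into `V`. -/
def IsHolomorphic (Λ : Submodule ℤ V) (φ : AddMonoid.End (V ⧸ Λ)) : Prop :=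
  ∀ v : V, ∃ h : V → V, ∀ᶠ w in 𝓝 v,
    DifferentiableAt ℂ h w ∧ φ (Λ.mkQ w) = Λ.mkQ (h w)

/-- `End(T)`: the ring of endomorphisms of the complex Lie group `T = V ⧸ Λ`, i.e. of the
holomorphic group homomorphisms `T → T`. -/
def EndT (Λ : Submodule ℤ V) : Subring (AddMonoid.End (V ⧸ Λ)) where
  carrier := {φ | IsHolomorphic Λ φ}
  one_mem' := fun _ => ⟨id, Filter.Eventually.of_forall fun _ => ⟨differentiableAt_id, rfl⟩⟩
  zero_mem' := fun _ => ⟨fun _ => 0, Filter.Eventually.of_forall fun _ =>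
    ⟨differentiableAt_const _, by simp⟩⟩
  add_mem' := by
    intro φ ψ hφ hψ v
    obtain ⟨h, hh⟩ := hφ v
    obtain ⟨k, hk⟩ := hψ v
    refine ⟨fun w => h w + k w, ?_⟩
    filter_upwards [hh, hk] with w h1 h2
    exact ⟨h1.1.add h2.1, by rw [map_add, ← h1.2, ← h2.2]; rfl⟩
  neg_mem' := by
    intro φ hφ v
    obtain ⟨h, hh⟩ := hφ v
    refine ⟨fun w => -h w, ?_⟩
    filter_upwards [hh] with w h1
    exact ⟨h1.1.neg, by rw [map_neg, ← h1.2]; rfl⟩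
  mul_mem' := by
    intro φ ψ hφ hψ v
    obtain ⟨k, hk⟩ := hψ v
    obtain ⟨h, hh⟩ := hφ (k v)
    refine ⟨fun w => h (k w), ?_⟩
    filter_upwards [hk, hk.self_of_nhds.1.continuousAt.eventually hh] with w h1 h2
    exact ⟨h2.1.comp w h1.1, by rw [← h2.2, ← h1.2]; rfl⟩

/-- `End⁰(T) = End(T) ⊗ ℚ`, a `ℚ`-algebra. -/
abbrev End0 (Λ : Submodule ℤ V) : Type u := ℚ ⊗[ℤ] (EndT Λ)

/-- `Aut(T) = End(T)ˣ`: the automorphism group of the complex Lie group `T`. -/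
abbrev AutT (Λ : Submodule ℤ V) : Type u := (EndT Λ)ˣ

/-- `T` is simple: `T ≠ 0` and there is no complex subtorus of `T` other than `0` and `T`. A complex
subtorus is given by a complex subspace `W` of `V` such that `W ∩ Λ` is a lattice in `W`
(it is always discrete, so this says that `W ∩ Λ` spans `W` over `ℝ`). -/
def IsSimple (Λ : Submodule ℤ V) : Prop :=
  Nontrivial V ∧ ∀ W : Submodule ℂ V,
    Submodule.span ℝ ((W : Set V) ∩ (Λ : Set V)) = W.restrictScalars ℝ → W = ⊥ ∨ W = ⊤

/-- `T` is a complex abelian variety: there is a Riemann form on `(V, Λ)`, i.e. an alternating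
`ℝ`-bilinear form `ω` on `V`, integral on `Λ`, with `ω(ix, iy) = ω(x, y)`, such that the symmetric
form `ω(ix, y)` is positive definite. -/
def IsAbelianVariety (Λ : Submodule ℤ V) : Prop :=
  ∃ ω : V [⋀^Fin 2]→ₗ[ℝ] ℝ,
    (∀ x ∈ Λ, ∀ y ∈ Λ, ∃ n : ℤ, ω ![x, y] = n) ∧
    (∀ x y : V, ω ![Complex.I • x, Complex.I • y] = ω ![x, y]) ∧
    (∀ x : V, x ≠ 0 → 0 < ω ![Complex.I • x, x])

end Endomorphisms

section Hodge

variable (V : Type u) [NormedAddCommGroup V] [NormedSpace ℂ V]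

/-- `H²(T, ℂ)`: the space `Hom_ℂ(⋀²(V ⊗_ℝ ℂ), ℂ)` of complex-valued alternating `ℝ`-bilinear
forms on `V = H₁(T, ℝ)`. -/
abbrev H2C : Type u := V [⋀^Fin 2]→ₗ[ℝ] ℂ

/-- `H^{2,0}(T) = Hom_ℂ(⋀² H_{-1,0}(T), ℂ)`: the holomorphic (that is, `ℂ`-bilinear) forms.
They are the forms whose extension to `V ⊗_ℝ ℂ` vanishes as soon as one argument is in
the `-i`-eigenspace `H_{0,-1}(T)` of the complex structure of `V`. -/
def H20 : Submodule ℂ (H2C V) where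
  carrier := {φ | ∀ x y : V, φ ![Complex.I • x, y] = Complex.I * φ ![x, y]}
  zero_mem' := by intro x y; simp
  add_mem' := by
    intro φ ψ hφ hψ x y
    simp only [AlternatingMap.add_apply, hφ x y, hψ x y, mul_add]
  smul_mem' := by
    intro c φ hφ x y
    simp only [AlternatingMap.smul_apply, hφ x y, smul_eq_mul]
    ring

/-- `H^{0,2}(T)`, the complex conjugate of `H^{2,0}(T)`: the `ℂ`-biantilinear forms. -/
def H02 : Submodule ℂ (H2C V) where
  carrier := {φ | ∀ x y : V, φ ![Complex.I • x, y] = -Complex.I * φ ![x, y]}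
  zero_mem' := by intro x y; simp
  add_mem' := by
    intro φ ψ hφ hψ x y
    simp only [AlternatingMap.add_apply, hφ x y, hψ x y, mul_add]
  smul_mem' := by
    intro c φ hφ x y
    simp only [AlternatingMap.smul_apply, hφ x y, smul_eq_mul]
    ring

/-- `H^{1,1}(T)`: the forms whose extension to `V ⊗_ℝ ℂ` vanishes on pairs of `i`-eigenvectors
and on pairs of `-i`-eigenvectors of the complex structure of `V`; equivalently, the forms
invariant under multiplication by `i` on `V`. -/
def H11 : Submodule ℂ (H2C V) where
  carrier := {φ | ∀ x y : V, φ ![Complex.I • x, Complex.I • y] = φ ![x, y]}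
  zero_mem' := by intro x y; simp
  add_mem' := by
    intro φ ψ hφ hψ x y
    simp only [AlternatingMap.add_apply, hφ x y, hψ x y]
  smul_mem' := by
    intro c φ hφ x y
    simp only [AlternatingMap.smul_apply, hφ x y]

variable {V}

/-- `H²(T, ℚ) = Hom_ℚ(⋀²_ℚ Λ_ℚ, ℚ)` as a `ℚ`-subspace of `H²(T, ℂ) = H²(T, ℚ) ⊗ ℂ`: the
forms that take rational values on the lattice. -/
noncomputable def H2Q (Λ : Submodule ℤ V) : Submodule ℚ (H2C V) where
  carrier := {φ | ∀ x ∈ Λ, ∀ y ∈ Λ, ∃ q : ℚ, φ ![x, y] = (q : ℂ)}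
  zero_mem' := by intro x _ y _; exact ⟨0, by simp⟩
  add_mem' := by
    intro φ ψ hφ hψ x hx y hy
    obtain ⟨p, hp⟩ := hφ x hx y hy
    obtain ⟨q, hq⟩ := hψ x hx y hy
    exact ⟨p + q, by simp only [AlternatingMap.add_apply, hp, hq, Rat.cast_add]⟩
  smul_mem' := by
    intro c φ hφ x hx y hy
    obtain ⟨p, hp⟩ := hφ x hx y hy
    exact ⟨c * p, by simp only [AlternatingMap.smul_apply, hp, Rat.smul_def, Rat.cast_mul]⟩

/-- The complexification `H_ℂ = H ⊗_ℚ ℂ ⊆ H²(T, ℂ)` of a `ℚ`-subspace `H` of `H²(T, ℚ)`. -/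
noncomputable def complexification (H : Submodule ℚ (H2C V)) : Submodule ℂ (H2C V) :=
  Submodule.span ℂ (H : Set (H2C V))

/-- `H` is a rational Hodge substructure of `H²(T, ℚ)`: a `ℚ`-subspace such that `H_ℂ` is the sum
of its intersections with the Hodge components of `H²(T, ℂ)`. -/
def IsHodgeSubstructure (Λ : Submodule ℤ V) (H : Submodule ℚ (H2C V)) : Prop :=
  H ≤ H2Q Λ ∧
    complexification H =
      (complexification H ⊓ H20 V) ⊔ (complexification H ⊓ H11 V) ⊔ (complexification H ⊓ H02 V)

/-- `T` is `2`-simple (irreducible in weight `2`). -/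
def IsTwoSimple (Λ : Submodule ℤ V) : Prop :=
  ∀ H : Submodule ℚ (H2C V), IsHodgeSubstructure Λ H →
    complexification H ⊓ H20 V ≠ ⊥ → H20 V ≤ complexification H

end Hodge

/-- A number field `E` is primitive: `E = ℚ`, or the only proper subfield of `E` is `ℚ`. -/
def IsPrimitiveField (E : Type u) [Field E] [NumberField E] : Prop :=
  ∀ F : IntermediateField ℚ E, F = ⊥ ∨ F = ⊤

end ComplexTorus

/-!
Everything rests on one principle. Let `S` be a complex subspace of `H²(T, ℂ)` that is defined over
`ℚ` and stable under the derivation `hodgeDer` given by the complex structure, whose eigenspaces are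
the Hodge components. Then `S` comes from a rational Hodge substructure, so if `S` contains a
nonzero holomorphic form and `T` is `2`-simple, it contains all of them (`IsTwoSimple.H20_le`).

* For a subtorus `W`, take the forms vanishing on `W × W` and those vanishing on `W × V`. Since
  `g ≥ 3`, one of them meets `H^{2,0}(T)` without containing it unless `W` is `0` or `V`
  (`IsTwoSimple.isSimple`).
* Let a number field `E` act on `V` preserving `Λ_ℚ`. If an embedding `σ` of `E` occurs twice in
  the dual of `V`, on independent functionals `l` and `m`, then `l ∧ m` lies in the substructure of
  forms for which `E` is self-adjoint. All holomorphic forms then lie in it, `E` acts by scalars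
  (`action_eq_smul`), and `E = ℚ` because `T` is simple. Otherwise `g ≤ [E : ℚ]`, and `[E : ℚ]`
  divides `2g`; so the degree is `1`, `g` or `2g`, and in degree `g` every embedding occurs
  (`finrank_and_embedding`).

Holomorphic endomorphisms lift to linear maps (`exists_linear_lift`), so `End⁰(T)` is the ring of
linear maps preserving `Λ_ℚ`. It is a division algebra because `T` is simple, its dimension is at
most `2g`, and all its subfields have degree `1`, `g` or `2g`. If it were not commutative, it would
have dimension two over a subfield of degree `g`, and the Cayley–Hamilton theorem would make the
generator of this subfield quadratic over the center, which is `ℚ`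
(`mul_comm_of_subfield_degrees`).

The rest is field theory. A Galois number field of even degree has, by Sylow's theorem, subfields of
degrees other than `1`, `g` and `2g` (`HasSubfieldDegrees.not_isGalois`). Hence `E = End⁰(T)`
contains no roots of unity but `±1`, and two different subfields of degree `g` cannot coexist in
degree `2g`, since their Galois groups would make `E` Galois. In degree `2g` a real embedding would
be a real functional on `V` multiplied by the complex structure with a real number of square `-1`
(`isEmpty_real_embedding`). In degree `g` a Riemann form gives the Rosati involution of `E`, which
must be trivial because its fixed field would have degree `g / 2`; so the eigenvalues of `E` on `V`
are real (`isTotallyReal_of_isAbelianVariety`). Finally `Aut(T)` is the unit group of the order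
`End(T)` in `E`, of the same rank as the units of the ring of integers
(`nonempty_units_order_equiv`).
-/

namespace ComplexTorus

/-! ### The rational span of the lattice -/

section RationalSpan

variable {V : Type u} [NormedAddCommGroup V] [NormedSpace ℂ V]

/-- The `ℚ`-vector space structure of a complex vector space. It is used as a local instance of low
priority, so that `ℂ` itself keeps its own `ℚ`-module structure. -/
@[reducible] noncomputable def ratModule : Module ℚ V := Module.compHom V (algebraMap ℚ ℂ)

attribute [local instance 50] ratModule

lemma ratCast_smul_complex (q : ℚ) (x : V) : q • x = (q : ℂ) • x := rfl

lemma ratCast_smul_real (q : ℚ) (x : V) : q • x = (q : ℝ) • x := by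
  rw [ratCast_smul_complex, ← Complex.ofReal_ratCast]
  exact Complex.coe_smul _ _

/-- `Λ_ℚ = Λ ⊗ ℚ`, the `ℚ`-span of the lattice in `V`. -/
noncomputable def ratSpan (Λ : Submodule ℤ V) : Submodule ℚ V := Submodule.span ℚ (Λ : Set V)

variable {Λ : Submodule ℤ V}

lemma mem_ratSpan_of_mem {x : V} (hx : x ∈ Λ) : x ∈ ratSpan Λ := Submodule.subset_span hx

lemma mem_ratSpan_iff {x : V} : x ∈ ratSpan Λ ↔ ∃ n : ℤ, n ≠ 0 ∧ n • x ∈ Λ := by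
  constructor
  · intro hx
    induction hx using Submodule.span_induction with
    | mem x hx => exact ⟨1, one_ne_zero, by simpa using hx⟩
    | zero => exact ⟨1, one_ne_zero, by simp⟩
    | add x y _ _ hx hy =>
      obtain ⟨n, hn, hnx⟩ := hx
      obtain ⟨m, hm, hmy⟩ := hy
      refine ⟨n * m, mul_ne_zero hn hm, ?_⟩
      rw [smul_add]
      refine Λ.add_mem ?_ ?_
      · rw [mul_comm, mul_smul]; exact Λ.smul_mem _ hnx
      · rw [mul_smul]; exact Λ.smul_mem _ hmy
    | smul q x _ hx =>
      obtain ⟨n, hn, hnx⟩ := hx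
      refine ⟨n * q.den, mul_ne_zero hn (by exact_mod_cast q.den_nz), ?_⟩
      have : (n * (q.den : ℤ)) • q • x = q.num • n • x := by
        simp only [← Int.cast_smul_eq_zsmul ℚ, smul_smul]
        congr 1
        have := Rat.mul_den_eq_num q
        push_cast
        linear_combination (n : ℚ) * this
      rw [this]
      exact Λ.smul_mem _ hnx
  · rintro ⟨n, hn, hnx⟩
    have : x = (n : ℚ)⁻¹ • n • x := by
      rw [← Int.cast_smul_eq_zsmul ℚ, smul_smul, inv_mul_cancel₀ (by exact_mod_cast hn), one_smul]
    rw [this]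
    exact Submodule.smul_mem _ _ (mem_ratSpan_of_mem hnx)

lemma span_ratSpan (Λ : Submodule ℤ V) [DiscreteTopology Λ] [IsZLattice ℝ Λ] :
    Submodule.span ℝ (ratSpan Λ : Set V) = ⊤ := by
  rw [eq_top_iff, ← IsZLattice.span_top (K := ℝ) (L := Λ)]
  exact Submodule.span_mono fun x hx => mem_ratSpan_of_mem hx

variable [FiniteDimensional ℂ V] (Λ) [DiscreteTopology Λ] [IsZLattice ℝ Λ]

/-- An `ℝ`-basis of `V` that is a `ℤ`-basis of `Λ`. -/
noncomputable def latBasis : Module.Basis (Module.Free.ChooseBasisIndex ℤ Λ) ℝ V :=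
  (Module.Free.chooseBasis ℤ Λ).ofZLatticeBasis ℝ Λ

lemma latBasis_mem (i) : latBasis Λ i ∈ Λ := by
  rw [latBasis, Module.Basis.ofZLatticeBasis_apply]
  exact Subtype.property _

lemma latBasis_repr_of_mem {x : V} (hx : x ∈ Λ) (i) : ∃ n : ℤ, (latBasis Λ).repr x i = n :=
  ⟨_, Module.Basis.ofZLatticeBasis_repr_apply ℝ Λ (Module.Free.chooseBasis ℤ Λ) ⟨x, hx⟩ i⟩

lemma latBasis_repr_of_mem_ratSpan {x : V} (hx : x ∈ ratSpan Λ) (i) :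
    ∃ q : ℚ, (latBasis Λ).repr x i = q := by
  obtain ⟨n, hn, hnx⟩ := mem_ratSpan_iff.1 hx
  obtain ⟨m, hm⟩ := latBasis_repr_of_mem Λ hnx i
  refine ⟨m / n, ?_⟩
  rw [← Int.cast_smul_eq_zsmul ℝ, map_smul, Finsupp.smul_apply, smul_eq_mul] at hm
  have : (n : ℝ) ≠ 0 := by exact_mod_cast hn
  push_cast
  field_simp
  linarith

/-- A `ℚ`-basis of `Λ_ℚ`. -/
noncomputable def ratBasis : Module.Basis (Module.Free.ChooseBasisIndex ℤ Λ) ℚ (ratSpan Λ) :=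
  Module.Basis.mk (v := fun i => ⟨latBasis Λ i, mem_ratSpan_of_mem (latBasis_mem Λ i)⟩)
    (by
      rw [Fintype.linearIndependent_iff]
      intro c hc i
      have h := Fintype.linearIndependent_iff.1 (latBasis Λ).linearIndependent (fun i => (c i : ℝ))
        (by
          have := congrArg (fun x : ratSpan Λ => (x : V)) hc
          simpa [ratCast_smul_real] using this) i
      exact_mod_cast h)
    (by
      rintro ⟨x, hx⟩ -
      choose q hq using latBasis_repr_of_mem_ratSpan Λ hx
      have : (⟨x, hx⟩ : ratSpan Λ) = ∑ i, q i •
          (⟨latBasis Λ i, mem_ratSpan_of_mem (latBasis_mem Λ i)⟩ : ratSpan Λ) := by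
        apply Subtype.ext
        simp only [Submodule.coe_sum, Submodule.coe_smul, ratCast_smul_real, ← hq]
        exact ((latBasis Λ).sum_repr x).symm
      rw [this]
      exact Submodule.sum_mem _ fun i _ => Submodule.smul_mem _ _ (Submodule.subset_span ⟨i, rfl⟩))

instance finite_ratSpan : Module.Finite ℚ (ratSpan Λ) := Module.Finite.of_basis (ratBasis Λ)

lemma finrank_ratSpan : Module.finrank ℚ (ratSpan Λ) = 2 * Module.finrank ℂ V := by
  rw [Module.finrank_eq_card_basis (ratBasis Λ), ← finrank_real_of_complex,
    Module.finrank_eq_card_basis (latBasis Λ)]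

/-- A real number that maps a nonzero vector of `Λ_ℚ` into `Λ_ℚ` is rational. -/
lemma rat_of_smul_mem_ratSpan {x : V} (hx : x ∈ ratSpan Λ) (hx0 : x ≠ 0) {r : ℝ}
    (hr : r • x ∈ ratSpan Λ) : ∃ q : ℚ, r = q := by
  obtain ⟨i, hi⟩ : ∃ i, (latBasis Λ).repr x i ≠ 0 := by
    by_contra! h
    exact hx0 ((latBasis Λ).repr.map_eq_zero_iff.1 (Finsupp.ext h))
  obtain ⟨p, hp⟩ := latBasis_repr_of_mem_ratSpan Λ hx i
  obtain ⟨q, hq⟩ := latBasis_repr_of_mem_ratSpan Λ hr i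
  rw [map_smul, Finsupp.smul_apply, smul_eq_mul, hp] at hq
  rw [hp] at hi
  exact ⟨q / p, by push_cast; field_simp; exact hq⟩

end RationalSpan

/-! ### Alternating forms of degree two -/

section Forms

variable {V : Type u} [NormedAddCommGroup V] [NormedSpace ℂ V]
  {N : Type*} [AddCommGroup N] [Module ℝ N]

lemma form_swap (ω : V [⋀^Fin 2]→ₗ[ℝ] N) (x y : V) : ω ![y, x] = -ω ![x, y] := by
  rw [← ω.map_swap ![x, y] (i := 0) (j := 1) (by decide)]
  congr 1
  ext i
  fin_cases i <;> rfl

lemma form_self (ω : V [⋀^Fin 2]→ₗ[ℝ] N) (x : V) : ω ![x, x] = 0 :=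
  ω.map_eq_zero_of_eq _ (i := 0) (j := 1) rfl (by decide)

/-- The bilinear map underlying an alternating form of degree two. -/
noncomputable def formBilin (ω : V [⋀^Fin 2]→ₗ[ℝ] N) : V →ₗ[ℝ] V →ₗ[ℝ] N :=
  LinearMap.mk₂ ℝ (fun x y => ω ![x, y]) (fun x x' y => ω.map_vecCons_add _ _ _)
    (fun c x y => ω.map_vecCons_smul _ _ _)
    (fun x y y' => by
      rw [form_swap, ω.map_vecCons_add, form_swap, form_swap ω x y', neg_add, neg_neg, neg_neg])
    (fun c x y => by rw [form_swap, ω.map_vecCons_smul, form_swap, smul_neg, neg_neg])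

@[simp] lemma formBilin_apply (ω : V [⋀^Fin 2]→ₗ[ℝ] N) (x y : V) :
    formBilin ω x y = ω ![x, y] := rfl

lemma form_ext {ω η : V [⋀^Fin 2]→ₗ[ℝ] N} (h : ∀ x y, ω ![x, y] = η ![x, y]) : ω = η := by
  ext m
  have : m = ![m 0, m 1] := by ext i; fin_cases i <;> rfl
  rw [this, h]

/-- The alternating form of degree two given by an alternating bilinear map. -/
noncomputable def altForm (B : V →ₗ[ℝ] V →ₗ[ℝ] N) (hB : ∀ x, B x x = 0) : V [⋀^Fin 2]→ₗ[ℝ] N where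
  toFun m := B (m 0) (m 1)
  map_update_add' m i x y := by fin_cases i <;> simp
  map_update_smul' m i c x := by fin_cases i <;> simp
  map_eq_zero_of_eq' m i j h hij := by
    have h01 : m 0 = m 1 := by
      fin_cases i <;> fin_cases j <;> simp_all
    rw [h01]
    exact hB _

@[simp] lemma altForm_apply (B : V →ₗ[ℝ] V →ₗ[ℝ] N) (hB : ∀ x, B x x = 0) (x y : V) :
    altForm B hB ![x, y] = B x y := rfl

lemma form_add_left (ω : V [⋀^Fin 2]→ₗ[ℝ] N) (x x' y : V) :
    ω ![x + x', y] = ω ![x, y] + ω ![x', y] := LinearMap.map_add₂ (formBilin ω) x x' y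

lemma form_add_right (ω : V [⋀^Fin 2]→ₗ[ℝ] N) (x y y' : V) :
    ω ![x, y + y'] = ω ![x, y] + ω ![x, y'] := map_add (formBilin ω x) y y'

lemma form_smul_left (ω : V [⋀^Fin 2]→ₗ[ℝ] N) (c : ℝ) (x y : V) :
    ω ![c • x, y] = c • ω ![x, y] := LinearMap.map_smul₂ (formBilin ω) c x y

lemma form_smul_right (ω : V [⋀^Fin 2]→ₗ[ℝ] N) (c : ℝ) (x y : V) :
    ω ![x, c • y] = c • ω ![x, y] := map_smul (formBilin ω x) c y

lemma form_neg_left (ω : V [⋀^Fin 2]→ₗ[ℝ] N) (x y : V) :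
    ω ![-x, y] = -ω ![x, y] := LinearMap.map_neg₂ (formBilin ω) x y

lemma form_neg_right (ω : V [⋀^Fin 2]→ₗ[ℝ] N) (x y : V) :
    ω ![x, -y] = -ω ![x, y] := map_neg (formBilin ω x) y

/-- The action of the complex structure on forms as a derivation:
`(x, y) ↦ ω(ix, y) + ω(x, iy)`. It is `2i` on `H^{2,0}`, `0` on `H^{1,1}`, `-2i` on `H^{0,2}`. -/
noncomputable def hodgeDer (ω : H2C V) : H2C V :=
  altForm
    ((formBilin ω) ∘ₗ (LinearMap.lsmul ℂ V Complex.I).restrictScalars ℝ +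
      (formBilin ω).compl₂ ((LinearMap.lsmul ℂ V Complex.I).restrictScalars ℝ))
    (fun x => by
      simp only [LinearMap.add_apply, LinearMap.comp_apply, LinearMap.compl₂_apply,
        LinearMap.coe_restrictScalars, LinearMap.lsmul_apply, formBilin_apply]
      rw [form_swap, neg_add_cancel])

@[simp] lemma hodgeDer_apply (ω : H2C V) (x y : V) :
    hodgeDer ω ![x, y] = ω ![Complex.I • x, y] + ω ![x, Complex.I • y] := rfl

lemma I_smul_I_smul (x : V) : Complex.I • Complex.I • x = -x := by
  rw [smul_smul, Complex.I_mul_I, neg_one_smul]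

/-- A complex subspace of `H²(T, ℂ)` stable under `hodgeDer` is the sum of its intersections with
the Hodge components, because these are the eigenspaces of `hodgeDer`. -/
lemma hodge_decomposition_of_hodgeDer {S : Submodule ℂ (H2C V)}
    (hS : ∀ ω ∈ S, hodgeDer ω ∈ S) :
    S = (S ⊓ H20 V) ⊔ (S ⊓ H11 V) ⊔ (S ⊓ H02 V) := by
  apply le_antisymm
  · intro ω hω
    have h1 := hS ω hω
    have h2 := hS _ h1
    have hI : Complex.I * Complex.I = -1 := Complex.I_mul_I
    set A : H2C V := -(1 / 8 : ℂ) • hodgeDer (hodgeDer ω) - (Complex.I / 4) • hodgeDer ω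
    set B : H2C V := ω + (1 / 4 : ℂ) • hodgeDer (hodgeDer ω)
    set C : H2C V := -(1 / 8 : ℂ) • hodgeDer (hodgeDer ω) + (Complex.I / 4) • hodgeDer ω
    have hsum : ω = A + B + C := by
      simp only [A, B, C]
      module
    rw [hsum]
    refine Submodule.add_mem_sup (Submodule.add_mem_sup ⟨?_, ?_⟩ ⟨?_, ?_⟩) ⟨?_, ?_⟩
    · exact S.sub_mem (S.smul_mem _ h2) (S.smul_mem _ h1)
    · intro x y
      simp only [A, AlternatingMap.sub_apply, AlternatingMap.smul_apply, hodgeDer_apply,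
        smul_eq_mul, I_smul_I_smul, form_neg_left, form_neg_right]
      linear_combination ((1 / 4 : ℂ) * (ω ![Complex.I • x, y] + ω ![x, Complex.I • y])) * hI
    · exact S.add_mem hω (S.smul_mem _ h2)
    · intro x y
      simp only [B, AlternatingMap.add_apply, AlternatingMap.smul_apply, hodgeDer_apply,
        smul_eq_mul, I_smul_I_smul, form_neg_left, form_neg_right]
      ring
    · exact S.add_mem (S.smul_mem _ h2) (S.smul_mem _ h1)
    · intro x y
      simp only [C, AlternatingMap.add_apply, AlternatingMap.smul_apply, hodgeDer_apply,
        smul_eq_mul, I_smul_I_smul, form_neg_left, form_neg_right]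
      linear_combination ((1 / 4 : ℂ) * (ω ![Complex.I • x, y] + ω ![x, Complex.I • y])) * hI
  · exact sup_le (sup_le inf_le_left inf_le_left) inf_le_left

end Forms

/-! ### Rational structure on forms and the use of `2`-simplicity -/

section TwoSimple

variable {V : Type u} [NormedAddCommGroup V] [NormedSpace ℂ V]

attribute [local instance 50] ratModule

lemma form_eq_zero_of_span {s t : Set V} {B : V →ₗ[ℝ] V →ₗ[ℝ] ℂ}
    (h : ∀ x ∈ s, ∀ y ∈ t, B x y = 0) {x y : V} (hx : x ∈ Submodule.span ℝ s)
    (hy : y ∈ Submodule.span ℝ t) : B x y = 0 := by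
  induction hx using Submodule.span_induction with
  | mem x hx =>
    induction hy using Submodule.span_induction with
    | mem y hy => exact h x hx y hy
    | zero => simp
    | add y y' _ _ h1 h2 => rw [map_add, h1, h2, add_zero]
    | smul c y _ h1 => rw [map_smul, h1, smul_zero]
  | zero => simp
  | add x x' _ _ h1 h2 => rw [LinearMap.map_add₂, h1, h2, add_zero]
  | smul c x _ h1 => rw [LinearMap.map_smul₂, h1, smul_zero]

variable [FiniteDimensional ℂ V] (Λ : Submodule ℤ V) [DiscreteTopology Λ] [IsZLattice ℝ Λ]

/-- For a `ℚ`-linear map `f : ℂ → ℚ` and a form `ω`, the form `ω_f` that is rational on `Λ` and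
agrees with `f ∘ ω` on `Λ_ℚ`. -/
noncomputable def ratPush (f : ℂ →ₗ[ℚ] ℚ) (ω : H2C V) : H2C V :=
  altForm
    (∑ i, ∑ j, ((LinearMap.mul ℝ ℝ).compl₁₂ ((latBasis Λ).coord i) ((latBasis Λ).coord j)).compr₂
      (LinearMap.toSpanSingleton ℝ ℂ ((f (ω ![latBasis Λ i, latBasis Λ j]) : ℚ) : ℂ)))
    (fun x => by
      simp only [LinearMap.sum_apply, LinearMap.compr₂_apply, LinearMap.compl₁₂_apply,
        LinearMap.mul_apply', LinearMap.toSpanSingleton_apply]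
      -- the double sum is its own negative, since its coefficients are antisymmetric
      rw [← self_eq_neg]
      conv_lhs => rw [Finset.sum_comm]
      rw [← Finset.sum_neg_distrib]
      refine Finset.sum_congr rfl fun i _ => ?_
      rw [← Finset.sum_neg_distrib]
      refine Finset.sum_congr rfl fun j _ => ?_
      rw [form_swap, map_neg, Rat.cast_neg, smul_neg, mul_comm])

lemma ratPush_apply (f : ℂ →ₗ[ℚ] ℚ) (ω : H2C V) (x y : V) :
    ratPush Λ f ω ![x, y] = ∑ i, ∑ j, ((latBasis Λ).repr x i * (latBasis Λ).repr y j) •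
      ((f (ω ![latBasis Λ i, latBasis Λ j]) : ℚ) : ℂ) := by
  simp [ratPush]

lemma form_eq_sum (ω : H2C V) (x y : V) :
    ω ![x, y] = ∑ i, ∑ j, ((latBasis Λ).repr x i * (latBasis Λ).repr y j) •
      ω ![latBasis Λ i, latBasis Λ j] := by
  rw [← formBilin_apply]
  conv_lhs => rw [← (latBasis Λ).sum_repr x, ← (latBasis Λ).sum_repr y]
  rw [LinearMap.map_sum₂]
  refine Finset.sum_congr rfl fun i _ => ?_
  rw [map_sum]
  refine Finset.sum_congr rfl fun j _ => ?_
  rw [LinearMap.map_smul₂, map_smul, smul_smul, formBilin_apply]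

lemma ratPush_apply_of_mem (f : ℂ →ₗ[ℚ] ℚ) (ω : H2C V) {x y : V} (hx : x ∈ ratSpan Λ)
    (hy : y ∈ ratSpan Λ) : ratPush Λ f ω ![x, y] = (f (ω ![x, y]) : ℚ) := by
  choose p hp using latBasis_repr_of_mem_ratSpan Λ hx
  choose q hq using latBasis_repr_of_mem_ratSpan Λ hy
  rw [ratPush_apply, form_eq_sum Λ ω x y]
  simp only [hp, hq, map_sum, Rat.cast_sum]
  refine Finset.sum_congr rfl fun i _ => Finset.sum_congr rfl fun j _ => ?_
  have : ((p i : ℝ) * (q j : ℝ)) • ω ![latBasis Λ i, latBasis Λ j]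
      = (p i * q j) • ω ![latBasis Λ i, latBasis Λ j] := by
    rw [Rat.smul_def, Complex.real_smul]
    push_cast
    rfl
  rw [this, map_smul, Complex.real_smul, smul_eq_mul]
  push_cast
  rfl

lemma ratPush_mem_H2Q (f : ℂ →ₗ[ℚ] ℚ) (ω : H2C V) : ratPush Λ f ω ∈ H2Q Λ :=
  fun _ hx _ hy => ⟨_, ratPush_apply_of_mem Λ f ω (mem_ratSpan_of_mem hx) (mem_ratSpan_of_mem hy)⟩

omit [FiniteDimensional ℂ V] in
lemma form_sum_apply {ι : Type*} (T : Finset ι) (η : ι → H2C V) (x y : V) :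
    (∑ t ∈ T, η t) ![x, y] = ∑ t ∈ T, η t ![x, y] := by
  classical
  induction T using Finset.induction_on with
  | empty => simp
  | insert a T ha ih =>
    rw [Finset.sum_insert ha, Finset.sum_insert ha, AlternatingMap.add_apply, ih]

/-- Every form is a `ℂ`-linear combination of its rational components `ω_f`: expand its values in
a `ℚ`-basis of `ℂ`. -/
lemma mem_span_ratPush (ω : H2C V) :
    ω ∈ Submodule.span ℂ (Set.range fun f : ℂ →ₗ[ℚ] ℚ => ratPush Λ f ω) := by
  classical
  set c := Module.Basis.ofVectorSpace ℚ ℂ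
  set T := Finset.univ.biUnion fun i => Finset.univ.biUnion fun j =>
    (c.repr (ω ![latBasis Λ i, latBasis Λ j])).support
  have key : ω = ∑ t ∈ T, c t • ratPush Λ (c.coord t) ω := by
    refine form_ext fun x y => ?_
    rw [form_sum_apply]
    simp only [AlternatingMap.smul_apply, ratPush_apply, smul_eq_mul, Finset.mul_sum]
    rw [form_eq_sum Λ ω x y]
    conv_rhs => rw [Finset.sum_comm]
    refine Finset.sum_congr rfl fun i _ => ?_
    conv_rhs => rw [Finset.sum_comm]
    refine Finset.sum_congr rfl fun j _ => ?_
    have hsub : (c.repr (ω ![latBasis Λ i, latBasis Λ j])).support ⊆ T := fun t ht =>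
      Finset.mem_biUnion.2 ⟨i, Finset.mem_univ _, Finset.mem_biUnion.2 ⟨j, Finset.mem_univ _, ht⟩⟩
    have hexp : ω ![latBasis Λ i, latBasis Λ j]
        = ∑ t ∈ T, c.repr (ω ![latBasis Λ i, latBasis Λ j]) t • c t := by
      conv_lhs => rw [← c.linearCombination_repr (ω ![latBasis Λ i, latBasis Λ j])]
      rw [Finsupp.linearCombination_apply, Finsupp.sum_of_support_subset _ hsub _ (by simp)]
    conv_lhs => rw [hexp]
    rw [Finset.smul_sum]
    refine Finset.sum_congr rfl fun t _ => ?_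
    simp only [Module.Basis.coord_apply, Rat.smul_def, Complex.real_smul]
    ring
  have hmem : ∑ t ∈ T, c t • ratPush Λ (c.coord t) ω ∈
      Submodule.span ℂ (Set.range fun f : ℂ →ₗ[ℚ] ℚ => ratPush Λ f ω) :=
    Submodule.sum_mem _ fun t _ => Submodule.smul_mem _ _ (Submodule.subset_span ⟨_, rfl⟩)
  rwa [← key] at hmem

variable {Λ}

/-- A complex subspace `S` of `H²(T, ℂ)` that is defined over `ℚ` (stable under `ω ↦ ω_f`) and
stable under the complex structure comes from a rational Hodge substructure, so if `T` is
`2`-simple and `S` meets `H^{2,0}(T)`, then it contains `H^{2,0}(T)`. -/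
lemma IsTwoSimple.H20_le (hT : IsTwoSimple Λ) {S : Submodule ℂ (H2C V)}
    (hder : ∀ ω ∈ S, hodgeDer ω ∈ S) (hrat : ∀ f, ∀ ω ∈ S, ratPush Λ f ω ∈ S)
    {ω : H2C V} (hω : ω ∈ S) (hω2 : ω ∈ H20 V) (hω0 : ω ≠ 0) : H20 V ≤ S := by
  have hsmul : ∀ (q : ℚ) (η : H2C V), q • η = (q : ℂ) • η := fun q η =>
    form_ext fun x y => by simp [AlternatingMap.smul_apply, Rat.smul_def]
  let H : Submodule ℚ (H2C V) :=
    { S.toAddSubmonoid ⊓ (H2Q Λ).toAddSubmonoid with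
      smul_mem' := fun q η hη => ⟨by
        rw [hsmul]; exact S.smul_mem _ hη.1, (H2Q Λ).smul_mem q hη.2⟩ }
  have hH : complexification H = S := by
    apply le_antisymm
    · exact Submodule.span_le.2 fun η hη => hη.1
    · intro η hη
      refine Submodule.span_le.2 ?_ (mem_span_ratPush Λ η)
      rintro _ ⟨f, rfl⟩
      exact Submodule.subset_span ⟨hrat f η hη, ratPush_mem_H2Q Λ f η⟩
  have := hT H ⟨fun η hη => hη.2, by rw [hH]; exact hodge_decomposition_of_hodgeDer hder⟩
  rw [hH] at this
  exact this fun h => hω0 ((Submodule.mem_bot ℂ).1 (h ▸ ⟨hω, hω2⟩))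

end TwoSimple

section Wedge

variable {V : Type u} [NormedAddCommGroup V] [NormedSpace ℂ V]

/-- The holomorphic form `λ ∧ μ` for linear functionals `λ`, `μ` on `V`. -/
noncomputable def wedge (l m : V →ₗ[ℂ] ℂ) : H2C V :=
  altForm
    ((LinearMap.mul ℝ ℂ).compl₁₂ (l.restrictScalars ℝ) (m.restrictScalars ℝ) -
      (LinearMap.mul ℝ ℂ).compl₁₂ (m.restrictScalars ℝ) (l.restrictScalars ℝ))
    (fun x => by simp [mul_comm])

@[simp] lemma wedge_apply (l m : V →ₗ[ℂ] ℂ) (x y : V) :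
    wedge l m ![x, y] = l x * m y - m x * l y := by
  simp [wedge]

lemma wedge_mem_H20 (l m : V →ₗ[ℂ] ℂ) : wedge l m ∈ H20 V := by
  intro x y
  simp only [wedge_apply, map_smul, smul_eq_mul]
  ring

lemma wedge_ne_zero {l m : V →ₗ[ℂ] ℂ} (hl : l ≠ 0) (hm : ∀ c : ℂ, m ≠ c • l) :
    wedge l m ≠ 0 := by
  intro h
  obtain ⟨x, hx⟩ : ∃ x, l x ≠ 0 := by
    by_contra! h'
    exact hl (LinearMap.ext h')
  apply hm (m x / l x)
  ext y
  have := congrArg (fun ω : H2C V => ω ![x, y]) h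
  simp only [wedge_apply, AlternatingMap.zero_apply] at this
  simp only [LinearMap.smul_apply, smul_eq_mul]
  field_simp
  linear_combination this

/-- If `y` is not a multiple of `x ≠ 0`, there is a holomorphic form with `ω(x, y) ≠ 0`. -/
lemma exists_H20_ne_zero {x y : V} (hx : x ≠ 0) (hy : ∀ c : ℂ, y ≠ c • x) :
    ∃ ω ∈ H20 V, ω ![x, y] ≠ 0 := by
  obtain ⟨m, hm, hm'⟩ := Submodule.exists_le_ker_of_notMem (p := Submodule.span ℂ {x}) (v := y)
    (by rw [Submodule.mem_span_singleton]; rintro ⟨c, rfl⟩; exact hy c rfl)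
  obtain ⟨l, hl, -⟩ := Submodule.exists_le_ker_of_notMem (p := (⊥ : Submodule ℂ V)) (v := x)
    (by simpa using hx)
  have hmx : m x = 0 := hm' (Submodule.mem_span_singleton_self x)
  exact ⟨wedge l m, wedge_mem_H20 l m, by simp [hmx, hl, hm]⟩

end Wedge

section Simple

variable {V : Type u} [NormedAddCommGroup V] [NormedSpace ℂ V] [FiniteDimensional ℂ V]
  {Λ : Submodule ℤ V} [DiscreteTopology Λ] [IsZLattice ℝ Λ]

attribute [local instance 50] ratModule

/-- The forms that vanish on `W × W'`. -/
noncomputable def vanishingForms (W W' : Submodule ℂ V) : Submodule ℂ (H2C V) where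
  carrier := {ω | ∀ x ∈ W, ∀ y ∈ W', ω ![x, y] = 0}
  zero_mem' := by intro x _ y _; simp
  add_mem' := by
    intro φ ψ hφ hψ x hx y hy
    rw [AlternatingMap.add_apply, hφ x hx y hy, hψ x hx y hy, add_zero]
  smul_mem' := by
    intro c φ hφ x hx y hy
    rw [AlternatingMap.smul_apply, hφ x hx y hy, smul_zero]

lemma H20_le_vanishingForms (hT : IsTwoSimple Λ) {W W' : Submodule ℂ V}
    (hW : Submodule.span ℝ ((W : Set V) ∩ (Λ : Set V)) = W.restrictScalars ℝ)
    (hW' : Submodule.span ℝ ((W' : Set V) ∩ (Λ : Set V)) = W'.restrictScalars ℝ)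
    {ω : H2C V} (hω : ω ∈ vanishingForms W W') (hω2 : ω ∈ H20 V) (hω0 : ω ≠ 0) :
    H20 V ≤ vanishingForms W W' := by
  refine hT.H20_le ?_ ?_ hω hω2 hω0
  · intro η hη x hx y hy
    rw [hodgeDer_apply, hη _ (W.smul_mem _ hx) _ hy, hη _ hx _ (W'.smul_mem _ hy), add_zero]
  · intro f η hη x hx y hy
    refine form_eq_zero_of_span (B := formBilin (ratPush Λ f η)) ?_
      (show x ∈ Submodule.span ℝ ((W : Set V) ∩ (Λ : Set V)) by rw [hW]; exact hx)
      (show y ∈ Submodule.span ℝ ((W' : Set V) ∩ (Λ : Set V)) by rw [hW']; exact hy)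
    rintro x ⟨hx, hxΛ⟩ y ⟨hy, hyΛ⟩
    rw [formBilin_apply, ratPush_apply_of_mem Λ f η (mem_ratSpan_of_mem hxΛ)
      (mem_ratSpan_of_mem hyΛ), hη x hx y hy, map_zero, Rat.cast_zero]

/-- A proper nonzero subtorus `W` gives two Hodge substructures, the forms that vanish on `W × W`
and those that vanish on `W × V`. The first forces `dim W = 1` and the second `dim V / W = 1`. -/
theorem IsTwoSimple.isSimple (hT : IsTwoSimple Λ) (hg : 3 ≤ Module.finrank ℂ V) :
    IsSimple Λ := by
  refine ⟨Module.nontrivial_of_finrank_pos (R := ℂ) (by omega), fun W hW => ?_⟩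
  by_contra! hne
  obtain ⟨hbot, htop⟩ := hne
  have hWtop : Submodule.span ℝ (((⊤ : Submodule ℂ V) : Set V) ∩ (Λ : Set V))
      = (⊤ : Submodule ℂ V).restrictScalars ℝ := by
    simp [IsZLattice.span_top]
  obtain ⟨x, hx, hx0⟩ := W.ne_bot_iff.1 hbot
  -- a functional that vanishes on `W`, and a second one, independent of it
  obtain ⟨z, -, hz⟩ := SetLike.exists_of_lt (lt_top_iff_ne_top.2 htop)
  obtain ⟨l, hlz, hl⟩ := Submodule.exists_le_ker_of_notMem hz
  have hl0 : l ≠ 0 := by rintro rfl; simp at hlz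
  have exists_not_mem : ∀ (P : Submodule ℂ V), Module.finrank ℂ P ≤ 2 → ∃ y, y ∉ P := by
    intro P hP
    by_contra! h
    rw [(Submodule.eq_top_iff'.2 h), finrank_top] at hP
    omega
  have span_two : ∀ a b : V, Module.finrank ℂ (Submodule.span ℂ {a, b}) ≤ 2 := by
    classical
    intro a b
    have := finrank_span_finset_le_card (R := ℂ) ({a, b} : Finset V)
    rw [Finset.coe_pair] at this
    exact this.trans Finset.card_le_two
  have indep : ∀ {m : V →ₗ[ℂ] ℂ} {y : V}, m y ≠ 0 → m z = 0 → ∀ c : ℂ, m ≠ c • l := by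
    rintro m y hy hmz c rfl
    have : c = 0 := by simpa [hlz] using hmz
    simp [this] at hy
  -- `W` is a line: a holomorphic form vanishes on `W × W`, so all of them do
  have hline : ∀ y ∈ W, ∃ c : ℂ, y = c • x := by
    obtain ⟨y, hy⟩ := exists_not_mem _ (span_two z z)
    obtain ⟨m, hmy, hm⟩ := Submodule.exists_le_ker_of_notMem hy
    have hle := H20_le_vanishingForms hT hW hW (ω := wedge l m)
      (fun a ha b hb => by
        have h1 : l a = 0 := hl ha
        have h2 : l b = 0 := hl hb
        simp [h1, h2])
      (wedge_mem_H20 l m)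
      (wedge_ne_zero hl0 (indep hmy (hm (Submodule.subset_span (by simp)))))
    intro y hy
    by_contra! h
    obtain ⟨ω, hω, hne⟩ := exists_H20_ne_zero hx0 h
    exact hne (hle hω x hx y hy)
  -- two independent functionals vanish on this line, so all holomorphic forms vanish on `W × V`
  obtain ⟨y, hy⟩ := exists_not_mem _ (span_two x z)
  obtain ⟨m, hmy, hm⟩ := Submodule.exists_le_ker_of_notMem hy
  have hmx : m x = 0 := hm (Submodule.subset_span (by simp))
  have hle := H20_le_vanishingForms hT hW hWtop (ω := wedge l m)
    (fun a ha b _ => by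
      obtain ⟨c, rfl⟩ := hline a ha
      have h1 : l x = 0 := hl hx
      simp [h1, hmx])
    (wedge_mem_H20 l m)
    (wedge_ne_zero hl0 (indep hmy (hm (Submodule.subset_span (by simp)))))
  obtain ⟨ω, hω, hne⟩ := exists_H20_ne_zero (y := y) hx0 (by
    rintro c rfl
    exact hy (Submodule.smul_mem _ _ (Submodule.subset_span (by simp))))
  exact hne (hle hω x hx y trivial)

end Simple

/-! ### Eigenspaces of a number field acting on a complex vector space -/

section Eigen

variable {E : Type*} [Field E] [NumberField E] {W : Type*} [AddCommGroup W] [Module ℂ W]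

/-- The subspace of `W` on which `E` acts through the embedding `σ`. -/
def eigenPart (ρ : E →+* Module.End ℂ W) (σ : E →+* ℂ) : Submodule ℂ W where
  carrier := {w | ∀ k, ρ k w = σ k • w}
  zero_mem' := by intro k; simp
  add_mem' := by intro v w hv hw k; rw [map_add, hv, hw, smul_add]
  smul_mem' := by intro c w hw k; rw [map_smul, hw, smul_comm]

lemma finrank_finset_sup_le {ι : Type*} [FiniteDimensional ℂ W] (T : Finset ι)
    (p : ι → Submodule ℂ W) :
    Module.finrank ℂ (T.sup p : Submodule ℂ W) ≤ ∑ i ∈ T, Module.finrank ℂ (p i) := by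
  classical
  induction T using Finset.induction_on with
  | empty => simp
  | insert a T ha ih =>
    rw [Finset.sup_insert, Finset.sum_insert ha]
    exact (Submodule.finrank_add_le_finrank_add_finrank _ _).trans (by omega)

/-- A generator of `E` acts semisimply and its eigenvalues are the conjugates of the generator, so
`W` is spanned by the subspaces on which `E` acts through an embedding. -/
lemma finrank_le_sum_eigenPart [FiniteDimensional ℂ W] (ρ : E →+* Module.End ℂ W) :
    Module.finrank ℂ W ≤ ∑ σ : E →+* ℂ, Module.finrank ℂ (eigenPart ρ σ) := by
  set pb := Field.powerBasisOfFiniteOfSeparable ℚ E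
  set T := ρ pb.gen
  set p := (minpoly ℚ pb.gen).map (algebraMap ℚ ℂ)
  have hp : Polynomial.aeval T p = 0 := by
    have h := Polynomial.hom_eval₂ (minpoly ℚ pb.gen) (algebraMap ℚ E) ρ pb.gen
    rw [← Polynomial.aeval_def, minpoly.aeval, map_zero] at h
    rw [Polynomial.aeval_def, Polynomial.eval₂_map, h]
    congr 1
    exact Subsingleton.elim _ _
  have hsq : Squarefree p :=
    (((minpoly.irreducible pb.isIntegral_gen).separable).map).squarefree
  have hss : T.IsSemisimple := Module.End.isSemisimple_of_squarefree_aeval_eq_zero hsq hp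
  have hle : ∀ μ : ℂ, Module.End.eigenspace T μ ≤ Finset.univ.sup (eigenPart ρ) := by
    intro μ w hw
    rcases eq_or_ne w 0 with rfl | hw0
    · exact Submodule.zero_mem _
    have hev : T.HasEigenvector μ w := ⟨hw, hw0⟩
    have hroot : Polynomial.aeval μ (minpoly ℚ pb.gen) = 0 := by
      have h := Module.End.aeval_apply_of_hasEigenvector (p := p) hev
      rw [hp, LinearMap.zero_apply] at h
      have h' := (smul_eq_zero.1 h.symm).resolve_right hw0
      rwa [Polynomial.eval_map_algebraMap] at h'
    set σ : E →ₐ[ℚ] ℂ := pb.lift μ hroot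
    have hσ : σ pb.gen = μ := pb.lift_gen μ hroot
    refine (Finset.le_sup (f := eigenPart ρ) (Finset.mem_univ (σ : E →+* ℂ))) ?_
    intro k
    have hk : k ∈ Algebra.adjoin ℚ {pb.gen} := by rw [pb.adjoin_gen_eq_top]; trivial
    induction hk using Algebra.adjoin_induction with
    | mem k hk =>
      rw [Set.mem_singleton_iff.1 hk]
      simpa [hσ] using Module.End.mem_eigenspace_iff.1 hw
    | algebraMap q =>
      have h : ρ (algebraMap ℚ E q) = algebraMap ℂ (Module.End ℂ W) q := by
        have : ρ.comp (algebraMap ℚ E)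
            = (algebraMap ℂ (Module.End ℂ W)).comp (algebraMap ℚ ℂ) := Subsingleton.elim _ _
        exact congrArg (fun f : ℚ →+* Module.End ℂ W => f q) this
      rw [h]
      simp
    | add a b _ _ ha hb => rw [map_add, LinearMap.add_apply, ha, hb, map_add, add_smul]
    | mul a b _ _ ha hb =>
      rw [map_mul, Module.End.mul_apply, hb, map_smul, ha, map_mul, smul_smul, mul_comm]
  have htop : Finset.univ.sup (eigenPart ρ) = ⊤ := by
    rw [eq_top_iff, ← hss.iSup_eigenspace_eq_top]
    exact iSup_le hle
  have := finrank_finset_sup_le Finset.univ (eigenPart ρ)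
  rwa [htop, finrank_top] at this

/-- The action of `E` on the dual space. -/
def dualAction (ρ : E →+* Module.End ℂ W) : E →+* Module.End ℂ (Module.Dual ℂ W) where
  toFun k := (ρ k).dualMap
  map_one' := by ext; simp
  map_mul' a b := by ext; rw [mul_comm]; simp
  map_zero' := by ext; simp
  map_add' a b := by ext; simp

omit [NumberField E] in
lemma mem_eigenPart_dualAction {ρ : E →+* Module.End ℂ W} {σ : E →+* ℂ} {l : Module.Dual ℂ W} :
    l ∈ eigenPart (dualAction ρ) σ ↔ ∀ k x, l (ρ k x) = σ k * l x :=
  ⟨fun h k x => LinearMap.congr_fun (h k) x, fun h k => LinearMap.ext (h k)⟩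

end Eigen

/-! ### Degrees of number fields acting on a `2`-simple torus -/

section Degree

variable {V : Type u} [NormedAddCommGroup V] [NormedSpace ℂ V]
  {Λ : Submodule ℤ V}
  {E : Type*} [Field E] [NumberField E] {j : E →+* Module.End ℂ V}

attribute [local instance 50] ratModule

lemma action_rat_smul (j : E →+* Module.End ℂ V) (q : ℚ) (k : E) (x : V) :
    j (q • k) x = q • j k x :=
  map_rat_smul ((LinearMap.applyₗ x).toAddMonoidHom.comp j.toAddMonoidHom) q k

omit [NumberField E] in
lemma action_injective (j : E →+* Module.End ℂ V) {x : V} (hx : x ≠ 0) {k : E}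
    (h : j k x = 0) : k = 0 := by
  by_contra hk
  have : j (k⁻¹ * k) x = 0 := by rw [map_mul, Module.End.mul_apply, h, map_zero]
  rw [inv_mul_cancel₀ hk, map_one] at this
  exact hx this

/-- `Λ_ℚ` as an `E`-vector space. -/
@[reducible] noncomputable def actionModule (hj : ∀ k, ∀ x ∈ ratSpan Λ, j k x ∈ ratSpan Λ) :
    Module E (ratSpan Λ) where
  smul k x := ⟨j k x, hj k x x.2⟩
  one_smul x := Subtype.ext (by change j 1 (x : V) = x; rw [map_one]; rfl)
  mul_smul a b x := Subtype.ext (by change j (a * b) (x : V) = j a (j b x); rw [map_mul]; rfl)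
  smul_zero a := Subtype.ext (map_zero (j a))
  smul_add a x y := Subtype.ext (map_add (j a) (x : V) y)
  add_smul a b x := Subtype.ext (by
    change j (a + b) (x : V) = j a x + j b x; rw [map_add]; rfl)
  zero_smul x := Subtype.ext (by change j 0 (x : V) = 0; rw [map_zero]; rfl)

variable [FiniteDimensional ℂ V] [DiscreteTopology Λ] [IsZLattice ℝ Λ]

lemma finrank_dvd (hj : ∀ k, ∀ x ∈ ratSpan Λ, j k x ∈ ratSpan Λ) :
    Module.finrank ℚ E ∣ 2 * Module.finrank ℂ V := by
  let _ := actionModule hj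
  have : IsScalarTower ℚ E (ratSpan Λ) :=
    ⟨fun q k x => Subtype.ext (action_rat_smul j q k x)⟩
  have : Module.Finite E (ratSpan Λ) := Module.Finite.of_restrictScalars_finite ℚ E _
  rw [← finrank_ratSpan Λ]
  exact Dvd.intro _ (Module.finrank_mul_finrank ℚ E (ratSpan Λ))

omit [FiniteDimensional ℂ V] in
lemma exists_mem_lattice_ne_zero [Nontrivial V] : ∃ x ∈ Λ, x ≠ 0 := by
  by_contra! h
  have h1 : (Λ : Set V) ⊆ {0} := fun x hx => h x hx
  have h2 := Submodule.span_mono (R := ℝ) h1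
  rw [IsZLattice.span_top (K := ℝ) (L := Λ), Submodule.span_zero_singleton] at h2
  exact absurd (le_bot_iff.1 h2) top_ne_bot

/-- The forms `ω` for which the action of `E` is self-adjoint. -/
noncomputable def selfAdjointForms (j : E →+* Module.End ℂ V) : Submodule ℂ (H2C V) where
  carrier := {ω | ∀ k x y, ω ![j k x, y] = ω ![x, j k y]}
  zero_mem' := by intro k x y; simp
  add_mem' := by
    intro φ ψ hφ hψ k x y
    rw [AlternatingMap.add_apply, AlternatingMap.add_apply, hφ, hψ]
  smul_mem' := by
    intro c φ hφ k x y
    rw [AlternatingMap.smul_apply, AlternatingMap.smul_apply, hφ]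

omit [NumberField E] in
/-- Two linear functionals `l`, `m` on which `E` acts through the same embedding `σ` give a
holomorphic form `l ∧ m` in the Hodge substructure of `E`-bilinear forms. If it is nonzero, all
holomorphic forms are `E`-bilinear, which is possible only if `E` acts by scalars. -/
lemma action_eq_smul (hT : IsTwoSimple Λ) (hj : ∀ k, ∀ x ∈ ratSpan Λ, j k x ∈ ratSpan Λ)
    {σ : E →+* ℂ} {l m : V →ₗ[ℂ] ℂ} (hl : ∀ k x, l (j k x) = σ k * l x)
    (hm : ∀ k x, m (j k x) = σ k * m x) (hl0 : l ≠ 0) (hlm : ∀ c : ℂ, m ≠ c • l)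
    (k : E) (x : V) : j k x = σ k • x := by
  have hle : H20 V ≤ selfAdjointForms j := by
    refine hT.H20_le ?_ ?_ (ω := wedge l m) ?_ (wedge_mem_H20 l m) (wedge_ne_zero hl0 hlm)
    · intro ω hω k x y
      rw [hodgeDer_apply, hodgeDer_apply, ← map_smul, ← map_smul, hω, hω]
    · intro f ω hω k x y
      have hspan : ∀ z : V, z ∈ Submodule.span ℝ (ratSpan Λ : Set V) := fun z => by
        rw [span_ratSpan]; trivial
      have h := form_eq_zero_of_span (s := (ratSpan Λ : Set V)) (t := (ratSpan Λ : Set V))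
        (B := formBilin (ratPush Λ f ω) ∘ₗ (j k).restrictScalars ℝ -
          (formBilin (ratPush Λ f ω)).compl₂ ((j k).restrictScalars ℝ))
        (fun a ha b hb => by
          simp only [LinearMap.sub_apply, LinearMap.comp_apply, LinearMap.compl₂_apply,
            LinearMap.coe_restrictScalars, formBilin_apply]
          rw [ratPush_apply_of_mem Λ f ω (hj k a ha) hb,
            ratPush_apply_of_mem Λ f ω ha (hj k b hb), hω, sub_self]) (hspan x) (hspan y)
      exact sub_eq_zero.1 h
    · intro k x y
      simp only [wedge_apply, hl, hm]
      ring
  -- every vector is an eigenvector, since `ω(kx, x) = ω(x, kx) = -ω(kx, x)`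
  have hev : ∀ (k : E) (x : V), ∃ c : ℂ, j k x = c • x := by
    intro k x
    rcases eq_or_ne x 0 with rfl | hx
    · exact ⟨0, by simp⟩
    by_contra! h
    obtain ⟨ω, hω, hne⟩ := exists_H20_ne_zero hx h
    have h1 := hle hω k x x
    rw [form_swap, neg_eq_self] at h1
    exact hne h1
  obtain ⟨c, hc⟩ := (j k).exists_eq_smul_id_of_forall_notLinearIndependent fun x hx => by
    obtain ⟨c, hc⟩ := hev k x
    have := (LinearIndependent.pair_iff.1 hx c (-1) (by rw [hc]; module)).2
    norm_num at this
  have hcx : ∀ x, j k x = c • x := fun x => by rw [hc]; rfl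
  obtain ⟨y, hy⟩ : ∃ y, l y ≠ 0 := by
    by_contra! h
    exact hl0 (LinearMap.ext h)
  have := hl k y
  rw [hcx, map_smul, smul_eq_mul] at this
  rw [hcx, mul_right_cancel₀ hy this]

/-- A field acting by scalars on a simple torus is `ℚ`: a non-real scalar would make every complex
line through a lattice point a subtorus. -/
lemma finrank_eq_one_of_scalar (hS : IsSimple Λ) (hg : 2 ≤ Module.finrank ℂ V)
    (hj : ∀ k, ∀ x ∈ ratSpan Λ, j k x ∈ ratSpan Λ) {σ : E →+* ℂ}
    (hσ : ∀ k x, j k x = σ k • x) : Module.finrank ℚ E = 1 := by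
  have := hS.1
  obtain ⟨x, hx, hx0⟩ := exists_mem_lattice_ne_zero (Λ := Λ)
  have hreal : ∀ k, (σ k).im = 0 := by
    intro k
    by_contra him
    obtain ⟨n, hn, hnx⟩ := mem_ratSpan_iff.1 (hj k x (mem_ratSpan_of_mem hx))
    have hW : Submodule.span ℝ (((Submodule.span ℂ {x} : Submodule ℂ V) : Set V) ∩ (Λ : Set V))
        = (Submodule.span ℂ {x} : Submodule ℂ V).restrictScalars ℝ := by
      apply le_antisymm
      · exact Submodule.span_le.2 fun y hy => hy.1
      · intro y hy
        obtain ⟨c, rfl⟩ := Submodule.mem_span_singleton.1 hy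
        have h1 : x ∈ Submodule.span ℝ
            (((Submodule.span ℂ {x} : Submodule ℂ V) : Set V) ∩ (Λ : Set V)) :=
          Submodule.subset_span ⟨Submodule.mem_span_singleton_self x, hx⟩
        have h2 : n • j k x ∈ Submodule.span ℝ
            (((Submodule.span ℂ {x} : Submodule ℂ V) : Set V) ∩ (Λ : Set V)) := by
          refine Submodule.subset_span ⟨?_, hnx⟩
          rw [hσ]
          exact (Submodule.span ℂ {x}).smul_of_tower_mem n
            (Submodule.smul_mem _ _ (Submodule.mem_span_singleton_self x))
        -- `x` and `k x` form a real basis of the line, since `σ k` is not real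
        have h3 : c • x = (c.re - c.im / (σ k).im * (σ k).re) • x
            + (c.im / (σ k).im / n) • n • j k x := by
          have hn' : (n : ℝ) ≠ 0 := by exact_mod_cast hn
          rw [hσ, ← Int.cast_smul_eq_zsmul ℝ, smul_smul, div_mul_cancel₀ _ hn',
            ← Complex.coe_smul, ← Complex.coe_smul, smul_smul, ← add_smul]
          congr 1
          apply Complex.ext
          · simp
          · simp
            field_simp
        rw [h3]
        exact Submodule.add_mem _ (Submodule.smul_mem _ _ h1) (Submodule.smul_mem _ _ h2)
    have hfin : Module.finrank ℂ (Submodule.span ℂ {x} : Submodule ℂ V) = 1 :=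
      finrank_span_singleton hx0
    rcases hS.2 _ hW with h | h
    · rw [h, finrank_bot] at hfin; omega
    · rw [h, finrank_top] at hfin; omega
  refine finrank_eq_one (1 : E) one_ne_zero fun k => ?_
  have hk : σ k = ((σ k).re : ℂ) := Complex.ext (by simp) (by simp [hreal])
  obtain ⟨q, hq⟩ := rat_of_smul_mem_ratSpan Λ (mem_ratSpan_of_mem hx) hx0 (r := (σ k).re) (by
    have := hj k x (mem_ratSpan_of_mem hx)
    rw [hσ, hk] at this
    simpa using this)
  refine ⟨q, σ.injective ?_⟩
  rw [hk, hq]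
  simp [Rat.smul_def]

/-- Unless `E` acts by scalars, each embedding occurs at most once in `V`, so
`g ≤ [E : ℚ]`; moreover `[E : ℚ]` divides `2g`. In degree `g` each embedding occurs. -/
theorem finrank_and_embedding (hT : IsTwoSimple Λ) (hg : 3 ≤ Module.finrank ℂ V)
    (hj : ∀ k, ∀ x ∈ ratSpan Λ, j k x ∈ ratSpan Λ) :
    (Module.finrank ℚ E = 1 ∨ Module.finrank ℚ E = Module.finrank ℂ V ∨
      Module.finrank ℚ E = 2 * Module.finrank ℂ V) ∧
    (Module.finrank ℚ E = Module.finrank ℂ V → ∀ σ : E →+* ℂ, ∃ l : V →ₗ[ℂ] ℂ, l ≠ 0 ∧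
      ∀ k x, l (j k x) = σ k * l x) := by
  by_cases h : ∀ σ : E →+* ℂ, Module.finrank ℂ (eigenPart (dualAction j) σ) ≤ 1
  · have hsum := finrank_le_sum_eigenPart (dualAction j)
    have hdual : Module.finrank ℂ (Module.Dual ℂ V) = Module.finrank ℂ V :=
      Subspace.dual_finrank_eq
    have hcard : Fintype.card (E →+* ℂ) = Module.finrank ℚ E := NumberField.Embeddings.card E ℂ
    rw [hdual] at hsum
    constructor
    · have hle : Module.finrank ℂ V ≤ Module.finrank ℚ E := by
        refine hsum.trans ((Finset.sum_le_sum fun σ _ => h σ).trans ?_)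
        simp [hcard]
      obtain ⟨m, hm⟩ := finrank_dvd hj
      -- `m [E : ℚ] = 2g ≤ 2 [E : ℚ]`
      have hm2 : m ≤ 2 := by
        by_contra! h3
        nlinarith
      interval_cases m
      · omega
      · right; right; omega
      · right; left; omega
    · intro hdeg σ
      have hpos : 0 < Module.finrank ℂ (eigenPart (dualAction j) σ) := by
        by_contra! h0
        have : ∑ τ : E →+* ℂ, Module.finrank ℂ (eigenPart (dualAction j) τ)
            < ∑ _τ : E →+* ℂ, 1 :=
          Finset.sum_lt_sum (fun τ _ => h τ) ⟨σ, Finset.mem_univ _, by omega⟩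
        simp [hcard] at this
        omega
      have := Module.finrank_pos_iff.1 hpos
      obtain ⟨⟨l, hl⟩, hl0⟩ := exists_ne (0 : eigenPart (dualAction j) σ)
      exact ⟨l, fun h' => hl0 (Subtype.ext h'), mem_eigenPart_dualAction.1 hl⟩
  · push Not at h
    obtain ⟨σ, hσ⟩ := h
    have : Nontrivial (eigenPart (dualAction j) σ) :=
      (Module.finrank_pos_iff (R := ℂ)).1 (by omega)
    obtain ⟨⟨l, hl⟩, hl0⟩ := exists_ne (0 : eigenPart (dualAction j) σ)
    have hm : ∃ m ∈ eigenPart (dualAction j) σ, ∀ c : ℂ, m ≠ c • l := by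
      by_contra! hall
      have := finrank_le_one (⟨l, hl⟩ : eigenPart (dualAction j) σ) fun w => by
        obtain ⟨c, hc⟩ := hall w w.2
        exact ⟨c, Subtype.ext hc.symm⟩
      omega
    obtain ⟨m, hm, hlm⟩ := hm
    have h1 := finrank_eq_one_of_scalar (hT.isSimple hg) (by omega) hj
      (action_eq_smul hT hj (mem_eigenPart_dualAction.1 hl) (mem_eigenPart_dualAction.1 hm)
        (fun h' => hl0 (Subtype.ext h')) hlm)
    exact ⟨Or.inl h1, fun h2 => by omega⟩

/-- If `[E : ℚ] = 2g`, then `V = E ⊗ ℝ`, so a real embedding of `E` is a real functional on `V` that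
is unique up to scalars; the complex structure maps it to a multiple `c` of itself, and
`c² = -1`. -/
theorem isEmpty_real_embedding [Nontrivial V] (hj : ∀ k, ∀ x ∈ ratSpan Λ, j k x ∈ ratSpan Λ)
    (hdeg : Module.finrank ℚ E = 2 * Module.finrank ℂ V) : IsEmpty (E →+* ℝ) := by
  refine ⟨fun τ => ?_⟩
  obtain ⟨x, hx, hx0⟩ := exists_mem_lattice_ne_zero (Λ := Λ)
  have hxL := mem_ratSpan_of_mem hx
  let f : E →ₗ[ℚ] ratSpan Λ :=
    { toFun := fun k => ⟨j k x, hj k x hxL⟩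
      map_add' := fun a b => Subtype.ext (by
        change j (a + b) x = j a x + j b x; rw [map_add]; rfl)
      map_smul' := fun q k => Subtype.ext (action_rat_smul j q k x) }
  have hfinj : Function.Injective f := (injective_iff_map_eq_zero f).2 fun k hk =>
    action_injective j hx0 (congrArg Subtype.val hk)
  have hfsurj : Function.Surjective f :=
    (LinearMap.injective_iff_surjective_of_finrank_eq_finrank
      (by rw [hdeg, finrank_ratSpan])).1 hfinj
  set b := Module.finBasis ℚ E
  let v : Fin (Module.finrank ℚ E) → V := fun i => j (b i) x
  have hspan : ⊤ ≤ Submodule.span ℝ (Set.range v) := by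
    rw [← span_ratSpan Λ, Submodule.span_le]
    intro y hy
    obtain ⟨k, hk⟩ := hfsurj ⟨y, hy⟩
    have hy' : y = j k x := (congrArg Subtype.val hk).symm
    rw [hy', ← b.sum_repr k, map_sum, LinearMap.sum_apply]
    refine Submodule.sum_mem _ fun i _ => ?_
    rw [action_rat_smul, ratCast_smul_real]
    exact Submodule.smul_mem _ _ (Submodule.subset_span ⟨i, rfl⟩)
  let B : Module.Basis (Fin (Module.finrank ℚ E)) ℝ V :=
    basisOfTopLeSpanOfCardEqFinrank v hspan
      (by rw [Fintype.card_fin, hdeg, finrank_real_of_complex])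
  have hB : ∀ i, B i = j (b i) x := fun i => by simp [B, v]
  let l : V →ₗ[ℝ] ℝ := B.constr ℝ fun i => τ (b i)
  have hl : ∀ k, l (j k x) = τ k := by
    intro k
    conv_lhs => rw [← b.sum_repr k]
    conv_rhs => rw [← b.sum_repr k]
    rw [map_sum, LinearMap.sum_apply, map_sum, map_sum]
    refine Finset.sum_congr rfl fun i _ => ?_
    rw [action_rat_smul, ratCast_smul_real, map_smul, map_rat_smul τ, ← hB, B.constr_basis,
      Rat.smul_def, smul_eq_mul]
  have hl2 : ∀ k y, l (j k y) = τ k * l y := by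
    intro k
    have : l ∘ₗ (j k).restrictScalars ℝ = τ k • l := B.ext fun i => by
      simp only [LinearMap.comp_apply, LinearMap.coe_restrictScalars, LinearMap.smul_apply,
        smul_eq_mul, hB]
      rw [← Module.End.mul_apply, ← map_mul, hl, hl, map_mul]
    exact LinearMap.congr_fun this
  set c := l (Complex.I • x)
  have hl3 : ∀ y, l (Complex.I • y) = c * l y := by
    have : l ∘ₗ (LinearMap.lsmul ℂ V Complex.I).restrictScalars ℝ = c • l := B.ext fun i => by
      simp only [LinearMap.comp_apply, LinearMap.coe_restrictScalars, LinearMap.smul_apply,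
        LinearMap.lsmul_apply, smul_eq_mul, hB]
      rw [← map_smul, hl2, hl, mul_comm]
    exact LinearMap.congr_fun this
  have h1 : l (Complex.I • Complex.I • x) = c * c := hl3 _
  have h2 : l x = 1 := by have := hl 1; rwa [map_one, map_one] at this
  rw [I_smul_I_smul, map_neg, h2] at h1
  nlinarith [mul_self_nonneg c]

end Degree

/-! ### Commutativity of division algebras with few subfields -/

section DivisionAlgebra

variable {D : Type*} [DivisionRing D] [CharZero D] [FiniteDimensional ℚ D]

/-- An element of a finite-dimensional division algebra generates a number field. -/
lemma exists_field_of_element (x : D) : ∃ (K : Type) (_ : Field K) (_ : NumberField K)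
    (i : K →+* D), Module.finrank ℚ K = (minpoly ℚ x).natDegree ∧ (∃ k, i k = x) ∧
      ∀ d, d * x = x * d → ∀ k, d * i k = i k * d := by
  have hx : IsIntegral ℚ x := Algebra.IsIntegral.isIntegral x
  have hirr : Fact (Irreducible (minpoly ℚ x)) := ⟨minpoly.irreducible hx⟩
  let pb := AdjoinRoot.powerBasis (minpoly.ne_zero hx)
  have hfin : Module.Finite ℚ (AdjoinRoot (minpoly ℚ x)) := pb.finite
  have hchar : CharZero (AdjoinRoot (minpoly ℚ x)) :=
    charZero_of_injective_algebraMap (algebraMap ℚ _).injective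
  let i : AdjoinRoot (minpoly ℚ x) →+* D :=
    Ideal.Quotient.lift (Ideal.span {minpoly ℚ x}) (Polynomial.aeval x).toRingHom (by
      intro p hp
      obtain ⟨q, rfl⟩ := Ideal.mem_span_singleton.1 hp
      change Polynomial.aeval x (minpoly ℚ x * q) = 0
      rw [map_mul, minpoly.aeval, zero_mul])
  have hi : ∀ p, i (AdjoinRoot.mk (minpoly ℚ x) p) = Polynomial.aeval x p := fun p => rfl
  refine ⟨AdjoinRoot (minpoly ℚ x), inferInstance, { }, i, ?_, ⟨AdjoinRoot.root _, ?_⟩, ?_⟩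
  · convert pb.finrank
    rw [AdjoinRoot.powerBasis_dim]
  · rw [AdjoinRoot.root, hi, Polynomial.aeval_X]
  · intro d hd k
    obtain ⟨p, rfl⟩ := AdjoinRoot.mk_surjective k
    rw [hi]
    induction p using Polynomial.induction_on' with
    | add p q hp hq => rw [map_add, mul_add, add_mul, hp, hq]
    | monomial n a =>
      rw [Polynomial.aeval_monomial]
      have h1 : Commute d (algebraMap ℚ D a) := Algebra.commute_algebraMap_right a d
      have h2 : Commute d (x ^ n) := Commute.pow_right hd n
      exact h1.mul_right h2

/-- `D` as a left vector space over a subfield. -/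
@[reducible] def leftModule {K : Type*} [Field K] (i : K →+* D) : Module K D :=
  Module.compHom D i

/-- Right multiplication by `x`, an endomorphism of `D` as a left vector space. -/
def rightMul {K : Type*} [Field K] (i : K →+* D) (x : D) :
    letI := leftModule i
    Module.End K D :=
  letI := leftModule i
  { toFun := fun d => d * x
    map_add' := fun a b => add_mul a b x
    map_smul' := fun k d => mul_assoc (i k) d x }

lemma finrank_mul_finrank_left {K : Type*} [Field K] [NumberField K] (i : K →+* D) :
    letI := leftModule i
    FiniteDimensional K D ∧ Module.finrank ℚ K * Module.finrank K D = Module.finrank ℚ D := by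
  let _ := leftModule i
  have : IsScalarTower ℚ K D := ⟨fun q k d => by
    change i (q • k) * d = q • (i k * d)
    rw [map_rat_smul i, smul_mul_assoc]⟩
  exact ⟨Module.Finite.of_restrictScalars_finite ℚ K D, Module.finrank_mul_finrank ℚ K D⟩

omit [CharZero D] [FiniteDimensional ℚ D] in
/-- If `D` has dimension two over a subfield containing `x`, the Cayley–Hamilton theorem for right
multiplication by `x` gives `a d + b d x + d x² = 0` for all `d`. Subtracting
`d (a + b x + x²) = 0` gives `[a, d] = -[b, d] x`, and since both commutators are derivations in
`d`, this forces `b` and then `a` to be central. -/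
lemma exists_quadratic_center {K : Type*} [Field K] (i : K →+* D)
    (hK : letI := leftModule i; Module.finrank K D = 2) {x y : D} (hxy : x * y ≠ y * x) :
    ∃ a b : D, (∀ d, a * d = d * a) ∧ (∀ d, b * d = d * b) ∧ a + b * x + x * x = 0 := by
  let _ := leftModule i
  have : FiniteDimensional K D := Module.finite_of_finrank_pos (by rw [hK]; norm_num)
  set χ := (rightMul i x).charpoly
  have hdeg : χ.natDegree = 2 := by rw [LinearMap.charpoly_natDegree, hK]
  have hlead : χ.coeff 2 = 1 := by
    have := (LinearMap.charpoly_monic (rightMul i x)).coeff_natDegree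
    rwa [hdeg] at this
  set a := i (χ.coeff 0)
  set b := i (χ.coeff 1)
  have key : ∀ d, a * d + b * (d * x) + d * x * x = 0 := by
    intro d
    have h := LinearMap.congr_fun (LinearMap.aeval_self_charpoly (rightMul i x)) d
    rw [Polynomial.aeval_eq_sum_range' (n := 3) (by change χ.natDegree < 3; omega), Finset.sum_range_succ,
      Finset.sum_range_succ, Finset.sum_range_one, hlead] at h
    simp only [pow_zero, pow_one, pow_two, one_smul] at h
    exact h
  have h1 : a + b * x + x * x = 0 := by simpa using key 1
  have hcomm : ∀ d, a * d - d * a = -(b * d - d * b) * x := by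
    intro d
    have h2 : d * (a + b * x + x * x) = 0 := by rw [h1, mul_zero]
    have h3 := key d
    rw [← sub_eq_zero, ← sub_eq_zero.2 (h3.trans h2.symm)]
    noncomm_ring
  have hb : ∀ d, b * d = d * b := by
    intro d
    have h2 : (b * d - d * b) * (x * y - y * x) = 0 := by
      have e1 := hcomm (d * y)
      have e2 := hcomm d
      have e3 := hcomm y
      have : a * (d * y) - d * y * a = (a * d - d * a) * y + d * (a * y - y * a) := by
        noncomm_ring
      rw [this, e2, e3, ← sub_eq_zero] at e1
      rw [← neg_eq_zero, ← e1]
      noncomm_ring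
    rcases mul_eq_zero.1 h2 with h | h
    · exact sub_eq_zero.1 h
    · exact absurd (sub_eq_zero.1 h) hxy
  refine ⟨a, b, fun d => ?_, hb, h1⟩
  have := hcomm d
  rw [hb, sub_self, neg_zero, zero_mul] at this
  exact sub_eq_zero.1 this

/-- A division algebra of dimension at most `2g`, `g ≥ 3`, all of whose subfields have degree `1`,
`g` or `2g`, is commutative. -/
theorem mul_comm_of_subfield_degrees {g : ℕ} (hg : 3 ≤ g) (hD : Module.finrank ℚ D ≤ 2 * g)
    (hdeg : ∀ (K : Type) [Field K] [NumberField K], (K →+* D) →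
      Module.finrank ℚ K = 1 ∨ Module.finrank ℚ K = g ∨ Module.finrank ℚ K = 2 * g)
    (x y : D) : x * y = y * x := by
  by_contra hxy
  -- a subfield of degree `dim D` would be all of `D`
  have hne : ∀ (K : Type) [Field K] [NumberField K] (i : K →+* D),
      Module.finrank ℚ K ≠ Module.finrank ℚ D := by
    intro K _ _ i h
    have hs : Function.Surjective i.toRatAlgHom.toLinearMap :=
      (LinearMap.injective_iff_surjective_of_finrank_eq_finrank h).1 i.injective
    obtain ⟨k, hk⟩ := hs x
    obtain ⟨l, hl⟩ := hs y
    have hk' : i k = x := hk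
    have hl' : i l = y := hl
    exact hxy (by rw [← hk', ← hl', ← map_mul, ← map_mul, mul_comm])
  -- subfields other than `ℚ` have degree `g`, and `D` has dimension two over them
  have hdim : ∀ (K : Type) [Field K] [NumberField K] (i : K →+* D), Module.finrank ℚ K ≠ 1 →
      Module.finrank ℚ K = g ∧ (letI := leftModule i; Module.finrank K D = 2) := by
    intro K _ _ i h1
    have h2 := (finrank_mul_finrank_left i).2
    have h3 := hne K i
    set n := (letI := leftModule i; Module.finrank K D)
    change _ * n = _ at h2
    have hn0 : n ≠ 0 := by
      rintro h0
      rw [h0, mul_zero] at h2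
      exact absurd h2 (Module.finrank_pos (R := ℚ) (M := D)).ne
    have hn1 : n ≠ 1 := by
      rintro h0
      rw [h0, mul_one] at h2
      exact h3 h2
    have hn2 : 2 ≤ n := by omega
    rcases hdeg K i with h | h | h
    · exact absurd h h1
    · exact ⟨h, by nlinarith⟩
    · nlinarith
  have hcentral : ∀ z : D, (minpoly ℚ z).natDegree = 1 → ∃ q : ℚ, z = algebraMap ℚ D q := by
    intro z hz
    obtain ⟨q, hq⟩ := minpoly.natDegree_eq_one_iff.1 hz
    exact ⟨q, hq.symm⟩
  have hx1 : (minpoly ℚ x).natDegree ≠ 1 := by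
    intro h
    obtain ⟨q, rfl⟩ := hcentral x h
    exact hxy (Algebra.commutes q y)
  -- the center is `ℚ`: otherwise `D` would be generated by `x` over its center
  have hcenter : ∀ z : D, (∀ d, z * d = d * z) → ∃ q : ℚ, z = algebraMap ℚ D q := by
    intro z hz
    obtain ⟨K, _, _, i, hfin, -, hcomm⟩ := exists_field_of_element z
    by_cases h1 : Module.finrank ℚ K = 1
    · exact hcentral z (by rw [← hfin, h1])
    exfalso
    have hiz : ∀ d k, d * i k = i k * d := fun d => hcomm d (hz d).symm
    let _ := leftModule i
    have h2 : Module.finrank K D = 2 := (hdim K i h1).2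
    have : FiniteDimensional K D := (finrank_mul_finrank_left i).1
    have hind : LinearIndependent K ![1, x] := by
      refine (LinearIndependent.pair_iff' one_ne_zero).2 fun k hk => ?_
      have hk' : i k * 1 = x := hk
      rw [mul_one] at hk'
      exact hxy (by rw [← hk', hiz])
    have hspan := hind.span_eq_top_of_card_eq_finrank' (by rw [h2, Fintype.card_fin])
    have hy : y ∈ Submodule.span K (Set.range ![1, x]) := by rw [hspan]; trivial
    rw [Matrix.range_cons, Matrix.range_cons, Matrix.range_empty, Set.union_empty,
      Set.singleton_union, Submodule.mem_span_pair] at hy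
    obtain ⟨k, l, hkl⟩ := hy
    have hkl' : i k * 1 + i l * x = y := hkl
    apply hxy
    rw [← hkl', mul_add, add_mul, mul_one, hiz, ← mul_assoc, hiz]
  obtain ⟨K, _, _, i, hfin, -, -⟩ := exists_field_of_element x
  obtain ⟨h1, h2⟩ := hdim K i (by rw [hfin]; exact hx1)
  obtain ⟨a, b, ha, hb, hab⟩ := exists_quadratic_center i h2 hxy
  obtain ⟨p, rfl⟩ := hcenter a ha
  obtain ⟨q, rfl⟩ := hcenter b hb
  have hmonic : (Polynomial.X ^ 2 + Polynomial.C q * Polynomial.X + Polynomial.C p).Monic := by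
    monicity!
  have hle := Polynomial.natDegree_le_natDegree (minpoly.min ℚ x hmonic (by
    simp only [map_add, map_mul, map_pow, Polynomial.aeval_X, Polynomial.aeval_C]
    rw [← hab, pow_two]
    abel))
  have : (Polynomial.X ^ 2 + Polynomial.C q * Polynomial.X + Polynomial.C p).natDegree ≤ 2 := by
    compute_degree!
  omega

end DivisionAlgebra

/-! ### Endomorphisms of a torus as linear maps -/

section Lift

variable {V : Type u} [NormedAddCommGroup V] [NormedSpace ℂ V] (Λ : Submodule ℤ V)

attribute [local instance 50] ratModule

/-- The `ℂ`-linear endomorphisms of `V` that preserve the lattice. -/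
def latEnd : Subring (Module.End ℂ V) where
  carrier := {f | ∀ x ∈ Λ, f x ∈ Λ}
  one_mem' := fun _ hx => hx
  zero_mem' := fun _ _ => Λ.zero_mem
  add_mem' := fun hf hg x hx => Λ.add_mem (hf x hx) (hg x hx)
  neg_mem' := fun hf x hx => Λ.neg_mem (hf x hx)
  mul_mem' := fun hf hg x hx => hf _ (hg x hx)

/-- The `ℂ`-linear endomorphisms of `V` that preserve `Λ_ℚ`. -/
noncomputable def ratEnd : Subring (Module.End ℂ V) where
  carrier := {f | ∀ x ∈ ratSpan Λ, f x ∈ ratSpan Λ}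
  one_mem' := fun _ hx => hx
  zero_mem' := fun _ _ => (ratSpan Λ).zero_mem
  add_mem' := fun hf hg x hx => (ratSpan Λ).add_mem (hf x hx) (hg x hx)
  neg_mem' := fun hf x hx => (ratSpan Λ).neg_mem (hf x hx)
  mul_mem' := fun hf hg x hx => hf _ (hg x hx)

lemma latEnd_le_ratEnd : latEnd Λ ≤ ratEnd Λ := by
  intro f hf x hx
  obtain ⟨n, hn, hnx⟩ := mem_ratSpan_iff.1 hx
  exact mem_ratSpan_iff.2 ⟨n, hn, by rw [← map_zsmul]; exact hf _ hnx⟩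

/-- The additive endomorphism of `V ⧸ Λ` induced by a linear map that preserves `Λ`. -/
def quotEnd (f : latEnd Λ) : AddMonoid.End (V ⧸ Λ) :=
  (Submodule.mapQ Λ Λ ((f : Module.End ℂ V).restrictScalars ℤ) f.2).toAddMonoidHom

omit [NormedSpace ℂ V] in
lemma addEnd_ext {φ ψ : AddMonoid.End (V ⧸ Λ)} (h : ∀ x, φ (Λ.mkQ x) = ψ (Λ.mkQ x)) : φ = ψ :=
  AddMonoidHom.ext fun t => by
    obtain ⟨x, rfl⟩ := Λ.mkQ_surjective t
    exact h x

variable [FiniteDimensional ℂ V]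

/-- The ring homomorphism from linear maps preserving `Λ` to endomorphisms of the torus. -/
def latEndToEndT : latEnd Λ →+* EndT Λ where
  toFun f := ⟨quotEnd Λ f, fun _ => ⟨(f : Module.End ℂ V), Filter.Eventually.of_forall fun _ =>
    ⟨(LinearMap.toContinuousLinearMap (f : Module.End ℂ V)).differentiableAt, rfl⟩⟩⟩
  map_one' := Subtype.ext (addEnd_ext Λ fun _ => rfl)
  map_mul' _ _ := Subtype.ext (addEnd_ext Λ fun _ => rfl)
  map_zero' := Subtype.ext (addEnd_ext Λ fun _ => rfl)
  map_add' _ _ := Subtype.ext (addEnd_ext Λ fun _ => rfl)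

variable [DiscreteTopology Λ]

omit [NormedSpace ℂ V] [FiniteDimensional ℂ V] in
lemma exists_ball_lattice : ∃ ε > 0, ∀ x ∈ Λ, ‖x‖ < ε → x = 0 := by
  obtain ⟨ε, hε, h⟩ := Metric.isOpen_iff.1 (isOpen_discrete ({0} : Set Λ)) 0 rfl
  refine ⟨ε, hε, fun x hx hxε => ?_⟩
  have : (⟨x, hx⟩ : Λ) ∈ Metric.ball (0 : Λ) ε := by
    rw [mem_ball_zero_iff]; exact hxε
  exact congrArg Subtype.val (h this)

omit [FiniteDimensional ℂ V] in
/-- A holomorphic endomorphism of the torus lifts to a linear map: a local holomorphic lift that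
vanishes at `0` is additive near `0` because `Λ` is discrete, so it agrees there with its
derivative. -/
lemma exists_linear_lift {φ : AddMonoid.End (V ⧸ Λ)} (hφ : IsHolomorphic Λ φ) :
    ∃ f : Module.End ℂ V, ∀ x, φ (Λ.mkQ x) = Λ.mkQ (f x) := by
  obtain ⟨h, hh⟩ := hφ 0
  set k : V → V := fun w => h w - h 0
  have hd : DifferentiableAt ℂ k 0 := hh.self_of_nhds.1.sub_const _
  have h0 : Λ.mkQ (h 0) = 0 := by rw [← hh.self_of_nhds.2, map_zero, map_zero]
  obtain ⟨ε, hε, hΛ⟩ := exists_ball_lattice Λ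
  have hsmall : ∀ᶠ w in 𝓝 (0 : V), ‖k w‖ < ε / 3 := by
    have hc : ContinuousAt (fun w => ‖k w‖) 0 := hd.continuousAt.norm
    refine hc.eventually_lt continuousAt_const ?_
    simp only [k, sub_self, norm_zero]
    positivity
  obtain ⟨δ, hδ, hball⟩ := Metric.eventually_nhds_iff_ball.1 (hh.and hsmall)
  have hk : ∀ w : V, ‖w‖ < δ → φ (Λ.mkQ w) = Λ.mkQ (k w) := fun w hw => by
    rw [(hball w (by simpa using hw)).1.2, map_sub, h0, sub_zero]
  have hk3 : ∀ w : V, ‖w‖ < δ → ‖k w‖ < ε / 3 := fun w hw => (hball w (by simpa using hw)).2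
  -- the defect of additivity is a lattice vector of norm less than `ε`
  have hadd : ∀ w w' : V, ‖w‖ < δ → ‖w'‖ < δ → ‖w + w'‖ < δ → k (w + w') = k w + k w' := by
    intro w w' hw hw' hww
    rw [← sub_eq_zero]
    apply hΛ
    · rw [← Submodule.Quotient.mk_eq_zero, ← Submodule.mkQ_apply, map_sub, map_add, ← hk _ hww,
        ← hk _ hw, ← hk _ hw', map_add, map_add, sub_self]
    · calc ‖k (w + w') - (k w + k w')‖ ≤ ‖k (w + w')‖ + (‖k w‖ + ‖k w'‖) :=
          (norm_sub_le _ _).trans (by gcongr; exact norm_add_le _ _)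
        _ < ε := by linarith [hk3 _ hw, hk3 _ hw', hk3 _ hww]
  -- by additivity near `0`, `k w = n • k (n⁻¹ • w)`, which tends to the derivative at `w`
  have hmul : ∀ (w : V) (n m : ℕ), ‖(n : ℂ) • w‖ < δ → m ≤ n → k ((m : ℂ) • w) = (m : ℂ) • k w := by
    intro w n m hn
    have hle : ∀ m : ℕ, m ≤ n → ‖(m : ℂ) • w‖ < δ := fun m hm => by
      refine lt_of_le_of_lt ?_ hn
      rw [norm_smul, norm_smul, Complex.norm_natCast, Complex.norm_natCast]
      gcongr
    induction m with
    | zero => intro _; simp [k]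
    | succ m ih =>
      intro hm
      have e : ((m + 1 : ℕ) : ℂ) • w = (m : ℂ) • w + w := by push_cast; module
      have h1 : ‖w‖ < δ := by simpa using hle 1 (by omega)
      rw [e, hadd _ _ (hle m (by omega)) h1 (by rw [← e]; exact hle _ hm), ih (by omega)]
      push_cast
      module
  set f := fderiv ℂ k 0
  have hf : ∀ w : V, ‖w‖ < δ → k w = f w := by
    intro w hw
    have hlim := hd.hasFDerivAt.lim w (c := fun n : ℕ => (n : ℂ)) (l := Filter.atTop)
      (by simpa using tendsto_natCast_atTop_atTop (R := ℝ))
    refine tendsto_nhds_unique (Filter.Tendsto.congr' ?_ tendsto_const_nhds) hlim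
    filter_upwards [Filter.eventually_gt_atTop 0] with n hn
    have hn' : (n : ℂ) ≠ 0 := by exact_mod_cast hn.ne'
    have hw' : (n : ℂ) • (n : ℂ)⁻¹ • w = w := by rw [smul_smul, mul_inv_cancel₀ hn', one_smul]
    have := hmul ((n : ℂ)⁻¹ • w) n n (by rwa [hw']) le_rfl
    rw [hw'] at this
    rw [this]
    simp [k]
  refine ⟨f, fun x => ?_⟩
  obtain ⟨n, hn⟩ := exists_nat_gt (‖x‖ / δ)
  have hn0 : (0 : ℝ) < n := lt_of_le_of_lt (by positivity) hn
  have hn' : (n : ℂ) ≠ 0 := by exact_mod_cast hn0.ne'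
  have hx' : x = n • ((n : ℂ)⁻¹ • x) := by
    rw [← Nat.cast_smul_eq_nsmul ℂ, smul_smul, mul_inv_cancel₀ hn', one_smul]
  have hlt : ‖(n : ℂ)⁻¹ • x‖ < δ := by
    rw [norm_smul, norm_inv, Complex.norm_natCast, inv_mul_lt_iff₀ hn0]
    rwa [div_lt_iff₀ hδ] at hn
  conv_lhs => rw [hx', map_nsmul, map_nsmul, hk _ hlt, hf _ hlt, ← map_nsmul]
  conv_rhs => rw [hx']
  congr 1
  exact (map_nsmul f _ _).symm

variable [IsZLattice ℝ Λ]

/-- A linear map with values in `Λ` is zero: `√2 • f x = f (√2 • x)` is in `Λ` as well, while only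
rational multiples of a nonzero lattice vector are in `Λ_ℚ`. -/
lemma eq_zero_of_forall_mem {f : Module.End ℂ V} (hf : ∀ x, f x ∈ Λ) : f = 0 := by
  ext x
  by_contra hx
  obtain ⟨q, hq⟩ := rat_of_smul_mem_ratSpan Λ (mem_ratSpan_of_mem (hf x)) hx (r := √2) (by
    have : (√2 : ℝ) • f x = f ((√2 : ℝ) • x) := ((f.restrictScalars ℝ).map_smul _ _).symm
    rw [this]
    exact mem_ratSpan_of_mem (hf _))
  exact irrational_sqrt_two ⟨q, hq.symm⟩

lemma latEndToEndT_bijective : Function.Bijective (latEndToEndT Λ) := by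
  constructor
  · refine (injective_iff_map_eq_zero _).2 fun f hf => Subtype.ext ?_
    refine eq_zero_of_forall_mem Λ fun x => ?_
    rw [← Submodule.Quotient.mk_eq_zero]
    exact DFunLike.congr_fun (congrArg Subtype.val hf) (Λ.mkQ x)
  · rintro ⟨φ, hφ⟩
    obtain ⟨f, hf⟩ := exists_linear_lift Λ hφ
    refine ⟨⟨f, fun x hx => ?_⟩, Subtype.ext (addEnd_ext Λ fun x => (hf x).symm)⟩
    rw [← Submodule.Quotient.mk_eq_zero, ← Submodule.mkQ_apply, ← hf,
      Submodule.mkQ_apply, (Submodule.Quotient.mk_eq_zero Λ).2 hx, map_zero]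

/-- `End(T)` is the ring of linear maps that preserve the lattice. -/
noncomputable def endTEquiv : EndT Λ ≃+* latEnd Λ :=
  (RingEquiv.ofBijective _ (latEndToEndT_bijective Λ)).symm

lemma exists_smul_mem_latEnd {f : Module.End ℂ V} (hf : f ∈ ratEnd Λ) :
    ∃ n : ℤ, n ≠ 0 ∧ n • f ∈ latEnd Λ := by
  choose n hn hnf using fun i =>
    mem_ratSpan_iff.1 (hf _ (mem_ratSpan_of_mem (latBasis_mem Λ i)))
  refine ⟨∏ i, n i, Finset.prod_ne_zero_iff.2 fun i _ => hn i, fun x hx => ?_⟩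
  choose m hm using latBasis_repr_of_mem Λ hx
  have hx' : x = ∑ i, m i • latBasis Λ i := by
    conv_lhs => rw [← (latBasis Λ).sum_repr x]
    exact Finset.sum_congr rfl fun i _ => by rw [hm, Int.cast_smul_eq_zsmul]
  rw [hx', map_sum]
  refine Λ.sum_mem fun i _ => ?_
  rw [map_zsmul]
  refine Λ.smul_mem _ ?_
  obtain ⟨c, hc⟩ := Finset.dvd_prod_of_mem n (Finset.mem_univ i)
  rw [LinearMap.smul_apply, hc, mul_comm, mul_smul]
  exact Λ.smul_mem _ (hnf i)

end Lift

/-! ### The endomorphism algebra -/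

section EndAlgebra

variable {V : Type u} [NormedAddCommGroup V] [NormedSpace ℂ V] [FiniteDimensional ℂ V]
  (Λ : Submodule ℤ V) [DiscreteTopology Λ] [IsZLattice ℝ Λ]

attribute [local instance 50] ratModule

/-- Every element of `ℚ ⊗ R` has a single denominator. -/
lemma exists_eq_inv_tmul {R : Type*} [Ring R] (t : ℚ ⊗[ℤ] R) :
    ∃ (n : ℤ) (a : R), n ≠ 0 ∧ t = (n : ℚ)⁻¹ ⊗ₜ[ℤ] a := by
  induction t with
  | zero => exact ⟨1, 0, one_ne_zero, by simp⟩
  | tmul q a =>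
    refine ⟨q.den, q.num • a, by exact_mod_cast q.den_nz, ?_⟩
    rw [← TensorProduct.smul_tmul]
    congr 1
    rw [zsmul_eq_mul]
    conv_lhs => rw [← Rat.num_div_den q]
    rw [div_eq_mul_inv]
    push_cast
    rfl
  | add s t hs ht =>
    obtain ⟨n, a, hn, rfl⟩ := hs
    obtain ⟨m, b, hm, rfl⟩ := ht
    refine ⟨n * m, m • a + n • b, mul_ne_zero hn hm, ?_⟩
    have hn' : (n : ℚ) ≠ 0 := by exact_mod_cast hn
    have hm' : (m : ℚ) ≠ 0 := by exact_mod_cast hm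
    rw [TensorProduct.tmul_add, ← TensorProduct.smul_tmul, ← TensorProduct.smul_tmul]
    congr 2
    · rw [zsmul_eq_mul]; push_cast; field_simp
    · rw [zsmul_eq_mul]; push_cast; field_simp

/-- The action of `End⁰(T)` on `V`. -/
noncomputable def end0Hom : End0 Λ →+* Module.End ℂ V :=
  (Algebra.TensorProduct.lift
    ((algebraMap ℂ (Module.End ℂ V)).comp (algebraMap ℚ ℂ)).toIntAlgHom
    ((latEnd Λ).subtype.comp (endTEquiv Λ).toRingHom).toIntAlgHom
    (fun q _ => Algebra.commute_algebraMap_left (q : ℂ) _)).toRingHom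

lemma end0Hom_tmul (q : ℚ) (a : EndT Λ) :
    end0Hom Λ (q ⊗ₜ a) = (q : ℂ) • (endTEquiv Λ a : Module.End ℂ V) := by
  refine (Algebra.TensorProduct.lift_tmul _ _ _ q a).trans ?_
  exact (Algebra.smul_def (q : ℂ) _).symm

lemma end0Hom_injective : Function.Injective (end0Hom Λ) := by
  refine (injective_iff_map_eq_zero _).2 fun t ht => ?_
  obtain ⟨n, a, hn, rfl⟩ := exists_eq_inv_tmul t
  rw [end0Hom_tmul] at ht
  have hn' : (((n : ℚ)⁻¹ : ℚ) : ℂ) ≠ 0 := by exact_mod_cast inv_ne_zero (Int.cast_ne_zero.2 hn)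
  have ha := (smul_eq_zero.1 ht).resolve_left hn'
  have : a = 0 := (endTEquiv Λ).map_eq_zero_iff.1 (Subtype.ext ha)
  rw [this, TensorProduct.tmul_zero]

lemma end0Hom_range : (end0Hom Λ).range = ratEnd Λ := by
  ext f
  constructor
  · rintro ⟨t, rfl⟩
    obtain ⟨n, a, hn, rfl⟩ := exists_eq_inv_tmul t
    rw [end0Hom_tmul]
    intro x hx
    exact (ratSpan Λ).smul_mem ((n : ℚ)⁻¹) (latEnd_le_ratEnd Λ (endTEquiv Λ a).2 x hx)
  · intro hf
    obtain ⟨n, hn, hnf⟩ := exists_smul_mem_latEnd Λ hf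
    refine ⟨(n : ℚ)⁻¹ ⊗ₜ (endTEquiv Λ).symm ⟨_, hnf⟩, ?_⟩
    rw [end0Hom_tmul, RingEquiv.apply_symm_apply]
    have hn' : (n : ℂ) ≠ 0 := by exact_mod_cast hn
    change (((n : ℚ)⁻¹ : ℚ) : ℂ) • (n • f) = f
    rw [← Int.cast_smul_eq_zsmul ℂ, smul_smul]
    push_cast
    rw [inv_mul_cancel₀ hn', one_smul]

/-- `End⁰(T)` is the ring of linear maps that preserve `Λ_ℚ`. -/
noncomputable def end0Equiv : End0 Λ ≃+* ratEnd Λ :=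
  (RingEquiv.ofBijective (end0Hom Λ).rangeRestrict
    ⟨fun _ _ h => end0Hom_injective Λ (congrArg Subtype.val h),
      (end0Hom Λ).rangeRestrict_surjective⟩).trans (RingEquiv.subringCongr (end0Hom_range Λ))

lemma end0Equiv_one_tmul (a : EndT Λ) :
    (end0Equiv Λ (1 ⊗ₜ a) : Module.End ℂ V) = endTEquiv Λ a := by
  change end0Hom Λ (1 ⊗ₜ a) = _
  rw [end0Hom_tmul, Rat.cast_one, one_smul]

variable {Λ}

/-- The image of a nonzero endomorphism of a simple torus is a nonzero subtorus, hence everything;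
so nonzero elements of `End⁰(T)` are invertible. -/
lemma isUnit_ratEnd (hS : IsSimple Λ) (f : ratEnd Λ) (hf : f ≠ 0) : IsUnit f := by
  obtain ⟨f, hfL⟩ := f
  have hf0 : f ≠ 0 := fun h => hf (Subtype.ext h)
  have hW : Submodule.span ℝ ((LinearMap.range f : Set V) ∩ (Λ : Set V))
      = (LinearMap.range f).restrictScalars ℝ := by
    apply le_antisymm
    · exact Submodule.span_le.2 fun y hy => hy.1
    · rintro _ ⟨x, rfl⟩
      have hx : x ∈ Submodule.span ℝ (Λ : Set V) := by
        rw [IsZLattice.span_top (K := ℝ) (L := Λ)]; trivial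
      induction hx using Submodule.span_induction with
      | mem x hx =>
        obtain ⟨n, hn, hnx⟩ := mem_ratSpan_iff.1 (hfL x (mem_ratSpan_of_mem hx))
        have hn' : (n : ℝ) ≠ 0 := by exact_mod_cast hn
        have : f x = (n : ℝ)⁻¹ • n • f x := by
          rw [← Int.cast_smul_eq_zsmul ℝ, smul_smul, inv_mul_cancel₀ hn', one_smul]
        rw [this]
        exact Submodule.smul_mem _ _ (Submodule.subset_span
          ⟨(LinearMap.range f).smul_of_tower_mem n ⟨x, rfl⟩, hnx⟩)
      | zero => rw [map_zero]; exact Submodule.zero_mem _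
      | add x y _ _ h1 h2 => rw [map_add]; exact Submodule.add_mem _ h1 h2
      | smul c x _ h1 =>
        rw [LinearMap.map_smul_of_tower]
        exact Submodule.smul_mem _ _ h1
  have htop : LinearMap.range f = ⊤ := (hS.2 _ hW).resolve_left fun h =>
    hf0 (LinearMap.range_eq_bot.1 h)
  have hsurj : Function.Surjective f := LinearMap.range_eq_top.1 htop
  have hinj : Function.Injective f := LinearMap.injective_iff_surjective.2 hsurj
  set e := LinearEquiv.ofBijective f ⟨hinj, hsurj⟩
  have hfe : ∀ x, f (e.symm x) = x := fun x => e.apply_symm_apply x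
  have hef : ∀ x, e.symm (f x) = x := fun x => e.symm_apply_apply x
  have heL : (e.symm : Module.End ℂ V) ∈ ratEnd Λ := by
    intro x hx
    let fL : ratSpan Λ →ₗ[ℚ] ratSpan Λ :=
      { toFun := fun y => ⟨f y, hfL y y.2⟩
        map_add' := fun a b => Subtype.ext (map_add f (a : V) b)
        map_smul' := fun q a => Subtype.ext (map_smul f (q : ℂ) (a : V)) }
    have hfLs : Function.Surjective fL := LinearMap.injective_iff_surjective.1
      fun a b h => Subtype.ext (hinj (congrArg Subtype.val h))
    obtain ⟨y, hy⟩ := hfLs ⟨x, hx⟩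
    have hy' : f y = x := congrArg Subtype.val hy
    rw [← hy']
    change e.symm (f y) ∈ _
    rw [hef]
    exact y.2
  exact ⟨⟨⟨f, hfL⟩, ⟨_, heL⟩, Subtype.ext (LinearMap.ext hfe), Subtype.ext (LinearMap.ext hef)⟩,
    rfl⟩

/-- `End⁰(T)` is a number field, realised by linear maps on `V` that preserve `Λ_ℚ`. -/
theorem exists_numberField (hT : IsTwoSimple Λ) (hg : 3 ≤ Module.finrank ℂ V) :
    ∃ (E : Type u) (_ : Field E) (_ : NumberField E), Nonempty (ratEnd Λ ≃+* E) := by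
  have hS := hT.isSimple hg
  have := hS.1
  obtain ⟨x, hx, hx0⟩ := exists_mem_lattice_ne_zero (Λ := Λ)
  have hxL := mem_ratSpan_of_mem hx
  let _ : DivisionRing (ratEnd Λ) := DivisionRing.ofIsUnitOrEqZero fun f => by
    rcases eq_or_ne f 0 with h | h
    · exact Or.inr h
    · exact Or.inl (isUnit_ratEnd hS f h)
  have hchar : CharZero (ratEnd Λ) := charZero_of_inj_zero fun n hn => by
    have h1 : ((n : ratEnd Λ) : Module.End ℂ V) x = 0 := by rw [hn]; rfl
    have h2 : (n : Module.End ℂ V) x = 0 := by simpa using h1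
    rw [Module.End.natCast_apply, ← Nat.cast_smul_eq_nsmul ℂ] at h2
    exact_mod_cast (smul_eq_zero.1 h2).resolve_right hx0
  let ev : ratEnd Λ →+ ratSpan Λ :=
    { toFun := fun f => ⟨(f : Module.End ℂ V) x, f.2 x hxL⟩
      map_zero' := rfl
      map_add' := fun _ _ => rfl }
  have hev : Function.Injective ev.toRatLinearMap := by
    refine (injective_iff_map_eq_zero _).2 fun f hf => ?_
    by_contra hf0
    obtain ⟨e, he⟩ := isUnit_ratEnd hS f hf0
    have h1 : (f : Module.End ℂ V) x = 0 := congrArg Subtype.val hf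
    have h2 : ((e⁻¹ : (ratEnd Λ)ˣ) : ratEnd Λ) * f = 1 := by rw [← he, Units.inv_mul]
    have h3 : ((((e⁻¹ : (ratEnd Λ)ˣ) : ratEnd Λ) * f : ratEnd Λ) : Module.End ℂ V) x = x := by
      rw [h2]; rfl
    rw [Subring.coe_mul, Module.End.mul_apply, h1, map_zero] at h3
    exact hx0 h3.symm
  have hfin : FiniteDimensional ℚ (ratEnd Λ) := Module.Finite.of_injective _ hev
  have hdim : Module.finrank ℚ (ratEnd Λ) ≤ 2 * Module.finrank ℂ V := by
    rw [← finrank_ratSpan Λ]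
    exact LinearMap.finrank_le_finrank_of_injective hev
  have hcomm := mul_comm_of_subfield_degrees hg hdim fun K _ _ i =>
    (finrank_and_embedding (j := (ratEnd Λ).subtype.comp i) hT hg fun k => (i k).2).1
  let F : Field (ratEnd Λ) := { (inferInstance : DivisionRing (ratEnd Λ)) with mul_comm := hcomm }
  exact ⟨ratEnd Λ, F, { to_charZero := hchar, to_finiteDimensional := hfin }, ⟨RingEquiv.refl _⟩⟩

end EndAlgebra

/-! ### Number fields whose subfields have degree `1`, `g` or `2g` -/

section SubfieldDegrees

/-- Every field that embeds into `E` has degree `1`, `g` or `2g` over `ℚ`. -/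
def HasSubfieldDegrees (E : Type u) [Field E] (g : ℕ) : Prop :=
  ∀ (K : Type u) [Field K] [NumberField K], (K →+* E) →
    Module.finrank ℚ K = 1 ∨ Module.finrank ℚ K = g ∨ Module.finrank ℚ K = 2 * g

variable {E : Type u} [Field E] [NumberField E] {g : ℕ}

omit [NumberField E] in
lemma HasSubfieldDegrees.of_ringHom (h : HasSubfieldDegrees E g) {F : Type u} [Field F]
    (i : F →+* E) : HasSubfieldDegrees F g := fun K _ _ k => h K (i.comp k)

lemma HasSubfieldDegrees.intermediate (h : HasSubfieldDegrees E g) (F : IntermediateField ℚ E) :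
    Module.finrank ℚ F = 1 ∨ Module.finrank ℚ F = g ∨ Module.finrank ℚ F = 2 * g :=
  h F (algebraMap F E)

/-- A Galois field of even degree has subfields of too many degrees, by Sylow's theorem: for
`g ≥ 3` the degrees of its subfields cannot all be `1`, `g` or `2g`. -/
lemma HasSubfieldDegrees.not_isGalois (h : HasSubfieldDegrees E g) (hg : 3 ≤ g)
    (heven : 2 ∣ Module.finrank ℚ E) : ¬ IsGalois ℚ E := by
  intro hgal
  have hsub : ∀ p n : ℕ, p.Prime → p ^ n ∣ Module.finrank ℚ E → ∃ m, m * p ^ n =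
      Module.finrank ℚ E ∧ (m = 1 ∨ m = g ∨ m = 2 * g) := by
    intro p n hp hdvd
    have : Fact p.Prime := ⟨hp⟩
    rw [← IsGalois.card_aut_eq_finrank] at hdvd
    obtain ⟨H, hH⟩ := Sylow.exists_subgroup_card_pow_prime p hdvd
    refine ⟨_, ?_, h.intermediate (IntermediateField.fixedField H)⟩
    rw [← hH, ← IntermediateField.finrank_fixedField_eq_card, Module.finrank_mul_finrank]
  rcases h E (RingHom.id E) with h1 | h1 | h1
  · omega
  · obtain ⟨m, hm, hm'⟩ := hsub 2 1 Nat.prime_two (by simpa using heven)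
    omega
  · by_cases h2 : Even g
    · obtain ⟨m, hm, hm'⟩ := hsub 2 2 Nat.prime_two (by
        obtain ⟨r, rfl⟩ := h2
        exact ⟨r, by omega⟩)
      omega
    · -- an odd prime divisor of `g`
      have hodd : Odd g := Nat.not_even_iff_odd.1 h2
      have hp : g.minFac.Prime := Nat.minFac_prime (by omega)
      have hpodd : Odd g.minFac := hodd.of_dvd_nat (Nat.minFac_dvd g)
      have hp3 : 3 ≤ g.minFac := by
        have := hp.two_le
        rcases hpodd with ⟨r, hr⟩
        omega
      obtain ⟨m, hm, hm'⟩ := hsub g.minFac 1 hp (by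
        rw [h1, pow_one]; exact (Nat.minFac_dvd g).mul_left 2)
      rw [pow_one, h1] at hm
      rcases hm' with rfl | rfl | rfl
      · rcases hpodd with ⟨r, hr⟩
        omega
      · nlinarith
      · nlinarith

/-- The only roots of unity in `E` are `±1`, because cyclotomic fields are Galois of even degree. -/
lemma HasSubfieldDegrees.root_of_unity (h : HasSubfieldDegrees E g) (hg : 3 ≤ g) {ζ : E} {n : ℕ}
    (hn : 0 < n) (hζ : ζ ^ n = 1) : ζ = 1 ∨ ζ = -1 := by
  have hfin : IsOfFinOrder ζ := isOfFinOrder_iff_pow_eq_one.2 ⟨n, hn, hζ⟩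
  have hprim := IsPrimitiveRoot.orderOf ζ
  set m := orderOf ζ
  have hm0 : 0 < m := hfin.orderOf_pos
  by_contra! hne
  have hm : 2 < m := by
    by_contra! hle
    interval_cases m
    · exact hne.1 (by simpa using hprim.pow_eq_one)
    · rcases mul_self_eq_one_iff.1 ((pow_two ζ).symm.trans hprim.pow_eq_one) with h' | h'
      · exact hne.1 h'
      · exact hne.2 h'
  have : NeZero m := ⟨hm0.ne'⟩
  let F := IntermediateField.adjoin ℚ {ζ}
  have hcyc : IsCyclotomicExtension {m} ℚ F :=
    hprim.intermediateField_adjoin_isCyclotomicExtension ℚ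
  have hdeg : Module.finrank ℚ F = m.totient :=
    IsCyclotomicExtension.finrank F (Polynomial.cyclotomic.irreducible_rat hm0)
  refine (h.of_ringHom (algebraMap F E)).not_isGalois hg ?_ (IsCyclotomicExtension.isGalois {m} ℚ F)
  rw [hdeg]
  exact (Nat.totient_even hm).two_dvd

lemma finrank_eq_iff_eq_bot_or_top (F : IntermediateField ℚ E) :
    (Module.finrank ℚ F = 1 ↔ F = ⊥) ∧ (Module.finrank ℚ F = Module.finrank ℚ E ↔ F = ⊤) := by
  refine ⟨IntermediateField.finrank_eq_one_iff, fun h => ?_, ?_⟩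
  · exact IntermediateField.eq_of_le_of_finrank_eq le_top (by rw [h, IntermediateField.finrank_top'])
  · rintro rfl
    exact IntermediateField.finrank_top'

/-- In degree `g` there are no subfields other than `ℚ` and `E`. -/
lemma HasSubfieldDegrees.isPrimitiveField (h : HasSubfieldDegrees E g) (hg : 3 ≤ g)
    (hdeg : Module.finrank ℚ E = g) : IsPrimitiveField E := by
  intro F
  rcases h.intermediate F with h' | h' | h'
  · exact Or.inl ((finrank_eq_iff_eq_bot_or_top F).1.1 h')
  · exact Or.inr ((finrank_eq_iff_eq_bot_or_top F).2.1 (h'.trans hdeg.symm))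
  · have := Module.finrank_mul_finrank ℚ F E
    have hpos : 0 < Module.finrank F E := Module.finrank_pos
    nlinarith

/-- In degree `2g`, proper subfields other than `ℚ` have degree `g`. If there were two of them, the
automorphisms of `E` would fix only `ℚ`, and `E` would be Galois. -/
lemma HasSubfieldDegrees.exists_unique_subfield (h : HasSubfieldDegrees E g) (hg : 3 ≤ g)
    (hdeg : Module.finrank ℚ E = 2 * g) (hprim : ¬ IsPrimitiveField E) :
    ∃ F : IntermediateField ℚ E, F ≠ ⊥ ∧ F ≠ ⊤ ∧ Module.finrank ℚ F = g ∧
      ∀ F' : IntermediateField ℚ E, F' ≠ ⊥ → F' ≠ ⊤ → F' = F := by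
  have hdegg : ∀ F : IntermediateField ℚ E, F ≠ ⊥ → F ≠ ⊤ → Module.finrank ℚ F = g := by
    intro F h0 h1
    rcases h.intermediate F with h' | h' | h'
    · exact absurd ((finrank_eq_iff_eq_bot_or_top F).1.1 h') h0
    · exact h'
    · exact absurd ((finrank_eq_iff_eq_bot_or_top F).2.1 (h'.trans hdeg.symm)) h1
  simp only [IsPrimitiveField, not_forall, not_or] at hprim
  obtain ⟨F, h0, h1⟩ := hprim
  refine ⟨F, h0, h1, hdegg F h0 h1, fun F' h0' h1' => ?_⟩
  by_contra hne
  refine h.not_isGalois hg ⟨g, hdeg⟩ (IsGalois.of_fixedField_eq_bot ℚ E ?_)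
  -- `E` is quadratic, hence Galois, over a subfield of degree `g`
  have hle : ∀ K : IntermediateField ℚ E, K ≠ ⊥ → K ≠ ⊤ →
      IntermediateField.fixedField (⊤ : Subgroup Gal(E/ℚ)) ≤ K := by
    intro K hK0 hK1 x hx
    have hmul := Module.finrank_mul_finrank ℚ K E
    rw [hdegg K hK0 hK1, hdeg] at hmul
    have hq : Algebra.IsQuadraticExtension K E :=
      { finrank_eq_two' := by
          have : g * Module.finrank K E = g * 2 := by rw [hmul, mul_comm]
          exact Nat.eq_of_mul_eq_mul_left (by omega) this }
    have hbot : x ∈ (⊥ : IntermediateField K E) := by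
      rw [IsGalois.mem_bot_iff_fixed]
      intro f
      exact hx ⟨f.restrictScalars ℚ, trivial⟩
    obtain ⟨y, rfl⟩ := IntermediateField.mem_bot.1 hbot
    exact y.2
  have hinf : F ⊓ F' = ⊥ := by
    by_contra hb
    have ht : F ⊓ F' ≠ ⊤ := fun ht => h1 (top_le_iff.1 (ht ▸ inf_le_left))
    have hd := hdegg _ hb ht
    have e1 := IntermediateField.eq_of_le_of_finrank_eq (inf_le_left : F ⊓ F' ≤ F)
      (hd.trans (hdegg F h0 h1).symm)
    have e2 := IntermediateField.eq_of_le_of_finrank_eq (inf_le_right : F ⊓ F' ≤ F')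
      (hd.trans (hdegg F' h0' h1').symm)
    exact hne (e2.symm.trans e1)
  exact le_bot_iff.1 (hinf ▸ le_inf (hle F h0 h1) (hle F' h0' h1'))

end SubfieldDegrees

/-! ### The Rosati involution -/

section Rosati

variable {V : Type u} [NormedAddCommGroup V] [NormedSpace ℂ V]
  {Λ : Submodule ℤ V} {ω : V [⋀^Fin 2]→ₗ[ℝ] ℝ}

attribute [local instance 50] ratModule

lemma riemann_rat (hΛ : ∀ x ∈ Λ, ∀ y ∈ Λ, ∃ n : ℤ, ω ![x, y] = n) {x y : V}
    (hx : x ∈ ratSpan Λ) (hy : y ∈ ratSpan Λ) : ∃ q : ℚ, ω ![x, y] = q := by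
  obtain ⟨n, hn, hnx⟩ := mem_ratSpan_iff.1 hx
  obtain ⟨m, hm, hmy⟩ := mem_ratSpan_iff.1 hy
  obtain ⟨r, hr⟩ := hΛ _ hnx _ hmy
  rw [← Int.cast_smul_eq_zsmul ℝ, ← Int.cast_smul_eq_zsmul ℝ, form_smul_left, form_smul_right,
    smul_eq_mul, smul_eq_mul] at hr
  refine ⟨r / (n * m), ?_⟩
  have hn' : (n : ℝ) ≠ 0 := by exact_mod_cast hn
  have hm' : (m : ℝ) ≠ 0 := by exact_mod_cast hm
  push_cast
  rw [← hr]
  field_simp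

lemma riemann_I_left (hI : ∀ x y : V, ω ![Complex.I • x, Complex.I • y] = ω ![x, y]) (x y : V) :
    ω ![Complex.I • x, y] = -ω ![x, Complex.I • y] := by
  rw [← hI x (Complex.I • y), I_smul_I_smul, form_neg_right, neg_neg]

lemma riemann_eq_zero (hpos : ∀ x : V, x ≠ 0 → 0 < ω ![Complex.I • x, x]) {y : V}
    (hy : ∀ x, ω ![x, y] = 0) : y = 0 := by
  by_contra h
  exact (hpos y h).ne' (hy _)

variable [FiniteDimensional ℂ V] [DiscreteTopology Λ] [IsZLattice ℝ Λ]

/-- A nondegenerate form that is rational on `Λ_ℚ` identifies `Λ_ℚ` with its own dual. -/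
lemma mem_ratSpan_of_riemann_rat (hΛ : ∀ x ∈ Λ, ∀ y ∈ Λ, ∃ n : ℤ, ω ![x, y] = n)
    (hpos : ∀ x : V, x ≠ 0 → 0 < ω ![Complex.I • x, x]) {z : V}
    (hz : ∀ x ∈ ratSpan Λ, ∃ q : ℚ, ω ![x, z] = q) : z ∈ ratSpan Λ := by
  have hbasis : ∀ {y : V}, (∀ i, ω ![latBasis Λ i, y] = 0) → y = 0 := by
    intro y hy
    apply riemann_eq_zero hpos
    intro x
    have : (formBilin ω).flip y = 0 := (latBasis Λ).ext fun i => hy i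
    exact LinearMap.congr_fun this x
  choose p hp using fun (y : ratSpan Λ) i =>
    riemann_rat hΛ (mem_ratSpan_of_mem (latBasis_mem Λ i)) y.2
  let G : ratSpan Λ →ₗ[ℚ] (Module.Free.ChooseBasisIndex ℤ Λ → ℚ) :=
    { toFun := p
      map_add' := fun a b => by
        ext i
        have h : ω ![latBasis Λ i, ((a + b : ratSpan Λ) : V)] = p a i + p b i := by
          rw [Submodule.coe_add, form_add_right, hp, hp]
        rw [hp] at h
        exact_mod_cast h
      map_smul' := fun q a => by
        ext i
        have h : ω ![latBasis Λ i, ((q • a : ratSpan Λ) : V)] = q * p a i := by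
          rw [Submodule.coe_smul, ratCast_smul_real, form_smul_right, hp, smul_eq_mul]
        rw [hp] at h
        exact_mod_cast h }
  have hGinj : Function.Injective G := by
    refine (injective_iff_map_eq_zero G).2 fun y hy => Subtype.ext (hbasis fun i => ?_)
    rw [hp]
    have : p y i = 0 := congrFun hy i
    rw [this, Rat.cast_zero]
  have hGsurj : Function.Surjective G :=
    (LinearMap.injective_iff_surjective_of_finrank_eq_finrank (by
      rw [Module.finrank_eq_card_basis (ratBasis Λ), Module.finrank_fintype_fun_eq_card])).1 hGinj
  choose r hr using fun i => hz _ (mem_ratSpan_of_mem (latBasis_mem Λ i))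
  obtain ⟨y, hy⟩ := hGsurj r
  have : z - y = 0 := hbasis fun i => by
    rw [sub_eq_add_neg, form_add_right, form_neg_right, hr, hp]
    have : p y i = r i := congrFun hy i
    rw [this, add_neg_cancel]
  rw [sub_eq_zero.1 this]
  exact y.2

/-- The adjoint of an endomorphism with respect to a Riemann form (Rosati involution). -/
lemma exists_rosati (hΛ : ∀ x ∈ Λ, ∀ y ∈ Λ, ∃ n : ℤ, ω ![x, y] = n)
    (hI : ∀ x y : V, ω ![Complex.I • x, Complex.I • y] = ω ![x, y])
    (hpos : ∀ x : V, x ≠ 0 → 0 < ω ![Complex.I • x, x]) {f : Module.End ℂ V} (hf : f ∈ ratEnd Λ) :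
    ∃ f' ∈ ratEnd Λ, ∀ x y, ω ![f x, y] = ω ![x, f' y] := by
  have hinj : Function.Injective (formBilin ω).flip :=
    (injective_iff_map_eq_zero _).2 fun y hy =>
      riemann_eq_zero hpos fun x => LinearMap.congr_fun hy x
  have hsurj : Function.Surjective (formBilin ω).flip :=
    (LinearMap.injective_iff_surjective_of_finrank_eq_finrank
      (Subspace.dual_finrank_eq (K := ℝ) (V := V)).symm).1 hinj
  choose f' hf' using fun y => hsurj ((formBilin ω).flip y ∘ₗ f.restrictScalars ℝ)
  have hadj : ∀ x y, ω ![f x, y] = ω ![x, f' y] := fun x y =>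
    (LinearMap.congr_fun (hf' y) x).symm
  have huniq : ∀ {y z : V}, (∀ x, ω ![x, y] = ω ![x, z]) → y = z := fun h =>
    hinj (LinearMap.ext h)
  have hadd : ∀ y z, f' (y + z) = f' y + f' z := fun y z => huniq fun x => by
    rw [← hadj, form_add_right, form_add_right, hadj, hadj]
  have hsmul : ∀ (c : ℝ) y, f' (c • y) = c • f' y := fun c y => huniq fun x => by
    rw [← hadj, form_smul_right, form_smul_right, hadj]
  have hIf : ∀ y, f' (Complex.I • y) = Complex.I • f' y := fun y => huniq fun x => by
    have h1 := riemann_I_left hI (f x) y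
    have h2 := riemann_I_left hI x (f' y)
    rw [← hadj, ← neg_eq_iff_eq_neg.2 h1, ← map_smul, hadj, h2, neg_neg]
  let F : Module.End ℂ V :=
    { toFun := f'
      map_add' := hadd
      map_smul' := fun c y => by
        have hc : ∀ z : V, c • z = c.re • z + c.im • Complex.I • z := fun z => by
          rw [← Complex.coe_smul, ← Complex.coe_smul, smul_smul, ← add_smul, Complex.re_add_im]
        rw [hc, hadd, hsmul, hsmul, hIf, RingHom.id_apply, hc] }
  refine ⟨F, fun y hy => mem_ratSpan_of_riemann_rat hΛ hpos fun x hx => ?_, hadj⟩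
  change ∃ q : ℚ, ω ![x, f' y] = q
  rw [← hadj]
  exact riemann_rat hΛ (hf x hx) hy

/-- If `End⁰(T)` is a field of degree `g`, the Rosati involution is trivial on it, since its fixed
field would otherwise have degree `g / 2`. Then all endomorphisms are self-adjoint with respect to
a positive definite Hermitian form, so their eigenvalues are real, and every embedding occurs among
the eigenvalues. -/
theorem isTotallyReal_of_isAbelianVariety (hT : IsTwoSimple Λ) (hg : 3 ≤ Module.finrank ℂ V)
    (hab : IsAbelianVariety Λ) {E : Type u} [Field E] [NumberField E]
    (e : ratEnd Λ ≃+* E) (hdeg : Module.finrank ℚ E = Module.finrank ℂ V) :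
    NumberField.IsTotallyReal E := by
  obtain ⟨ω, hΛ, hI, hpos⟩ := hab
  have : Nontrivial V := Module.nontrivial_of_finrank_pos (R := ℂ) (by omega)
  let j : E →+* Module.End ℂ V := (ratEnd Λ).subtype.comp e.symm.toRingHom
  have hj : ∀ k, j k ∈ ratEnd Λ := fun k => (e.symm k).2
  have hjinj : Function.Injective j := j.injective
  have huniq : ∀ {a b : E}, (∀ x y, ω ![x, j a y] = ω ![x, j b y]) → a = b := fun {a b} h =>
    hjinj (LinearMap.ext fun y => by
      rw [← sub_eq_zero]
      refine riemann_eq_zero hpos fun x => ?_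
      rw [sub_eq_add_neg, form_add_right, form_neg_right, h, add_neg_cancel])
  have hex : ∀ k, ∃ k', ∀ x y, ω ![j k x, y] = ω ![x, j k' y] := by
    intro k
    obtain ⟨f', hf', h⟩ := exists_rosati hΛ hI hpos (hj k)
    refine ⟨e ⟨f', hf'⟩, fun x y => ?_⟩
    rw [h]
    simp [j]
  choose t ht using hex
  let θ : E →+* E :=
    { toFun := t
      map_one' := huniq fun x y => by rw [← ht, map_one]; rfl
      map_zero' := huniq fun x y => by
        rw [← ht, map_zero, LinearMap.zero_apply, LinearMap.zero_apply]
        have h1 := form_smul_left ω 0 x y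
        have h2 := form_smul_right ω 0 x y
        rw [zero_smul, zero_smul] at h1 h2
        rw [h1, h2]
      map_add' := fun a b => huniq fun x y => by
        rw [← ht, map_add, map_add, LinearMap.add_apply, LinearMap.add_apply, form_add_left,
          form_add_right, ht, ht]
      map_mul' := fun a b => huniq fun x y => by
        rw [← ht, mul_comm (t a), map_mul, map_mul, Module.End.mul_apply, Module.End.mul_apply, ht,
          ht] }
  have hθθ : ∀ k, θ (θ k) = k := fun k => huniq fun x y => by
    change ω ![x, j (t (t k)) y] = _
    rw [← ht, form_swap, ← ht, form_swap, neg_neg]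
  have hid : ∀ k, t k = k := by
    by_contra! hne
    obtain ⟨k, hk⟩ := hne
    let s : Gal(E/ℚ) := AlgEquiv.ofAlgHom θ.toRatAlgHom θ.toRatAlgHom
      (AlgHom.ext hθθ) (AlgHom.ext hθθ)
    have hs : orderOf s = 2 := orderOf_eq_prime
      (by rw [pow_two]; exact AlgEquiv.ext hθθ)
      (fun h => hk (DFunLike.congr_fun h k))
    have hcard := IntermediateField.finrank_fixedField_eq_card (Subgroup.zpowers s)
    rw [Nat.card_zpowers, hs] at hcard
    have hmul := Module.finrank_mul_finrank ℚ (IntermediateField.fixedField (Subgroup.zpowers s)) E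
    rw [hcard, hdeg] at hmul
    have := (finrank_and_embedding hT hg (E := IntermediateField.fixedField (Subgroup.zpowers s))
      (j := j.comp (algebraMap _ E)) fun k => hj _).1
    omega
  have hreal : ∀ (σ : E →+* ℂ) k, (σ k).im = 0 := by
    intro σ k
    obtain ⟨l, hl0, hl⟩ := (finrank_and_embedding (j := j) hT hg hj).2 hdeg σ
    have hns : ¬ Function.Surjective (j k - algebraMap ℂ (Module.End ℂ V) (σ k)) := by
      intro hs
      apply hl0
      ext y
      obtain ⟨x, rfl⟩ := hs y
      simp [hl]
    have hni := mt LinearMap.injective_iff_surjective.1 hns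
    rw [injective_iff_map_eq_zero] at hni
    push Not at hni
    obtain ⟨v, hv, hv0⟩ := hni
    have hv' : j k v = (σ k).re • v + (σ k).im • Complex.I • v := by
      rw [← Complex.coe_smul, ← Complex.coe_smul, smul_smul, ← add_smul, Complex.re_add_im]
      rw [LinearMap.sub_apply, sub_eq_zero] at hv
      simpa using hv
    have h := ht k v v
    rw [hid, hv', form_add_left, form_add_right, form_smul_left, form_smul_left, form_smul_right,
      form_smul_right, form_swap ω (Complex.I • v) v, form_self] at h
    simp only [smul_eq_mul] at h
    have h1 := hpos v hv0
    have h2 : (σ k).im * ω ![Complex.I • v, v] = 0 := by linarith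
    exact (mul_eq_zero.1 h2).resolve_right h1.ne'
  refine ⟨fun w => NumberField.InfinitePlace.isReal_iff.2 ?_⟩
  rw [NumberField.ComplexEmbedding.isReal_iff]
  ext k
  rw [NumberField.ComplexEmbedding.conjugate_coe_eq]
  exact Complex.conj_eq_iff_im.2 (hreal _ k)

end Rosati

/-! ### Units of orders -/

section Units

open NumberField

variable {E : Type u} [Field E] [NumberField E] {R : Subring E}

/-- An order contains a nonzero integer multiple of the ring of integers. -/
lemma exists_mul_mem_order (hQ : ∀ x : E, ∃ n : ℤ, n ≠ 0 ∧ (n : E) * x ∈ R) :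
    ∃ n : ℤ, n ≠ 0 ∧ ∀ x : 𝓞 E, (n : E) * x ∈ R := by
  set b := RingOfIntegers.basis E
  choose n hn hnR using fun i => hQ (b i : E)
  refine ⟨∏ i, n i, Finset.prod_ne_zero_iff.2 fun i _ => hn i, fun x => ?_⟩
  have hx : (x : E) = ∑ i, ((b.repr x i : ℤ) : E) * (b i : E) := by
    conv_lhs => rw [← b.sum_repr x]
    simp [map_sum]
  rw [hx, Finset.mul_sum]
  refine R.sum_mem fun i _ => ?_
  obtain ⟨c, hc⟩ := Finset.dvd_prod_of_mem n (Finset.mem_univ i)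
  have : ((∏ i, n i : ℤ) : E) * (((b.repr x i : ℤ) : E) * (b i : E))
      = ((c * b.repr x i : ℤ) : E) * ((n i : E) * (b i : E)) := by
    rw [hc]; push_cast; ring
  rw [this]
  exact R.mul_mem (intCast_mem R _) (hnR i)

/-- The inclusion of the units of an order into the units of the ring of integers. -/
def orderUnits (hint : ∀ x ∈ R, IsIntegral ℤ x) : Rˣ →* (𝓞 E)ˣ :=
  Units.map (RingOfIntegers.restrict_monoidHom (R.subtype : R →* E) fun x => hint x x.2)

/-- Some power of every unit of the ring of integers is a unit of the order: if `n 𝓞 ⊆ R`, take the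
order of `(𝓞 / n)ˣ` as exponent. -/
lemma exists_pow_mem_range_orderUnits (hint : ∀ x ∈ R, IsIntegral ℤ x)
    (hQ : ∀ x : E, ∃ n : ℤ, n ≠ 0 ∧ (n : E) * x ∈ R) :
    ∃ m : ℕ, 0 < m ∧ ∀ x : (𝓞 E)ˣ, x ^ m ∈ (orderUnits hint).range := by
  obtain ⟨n, hn, hnR⟩ := exists_mul_mem_order hQ
  set I : Ideal (𝓞 E) := Ideal.span {(n : 𝓞 E)}
  have hI : I ≠ ⊥ := by
    rw [Ne, Ideal.span_singleton_eq_bot]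
    exact_mod_cast hn
  have : Finite (𝓞 E ⧸ I) := Ideal.finiteQuotientOfFreeOfNeBot I hI
  have : Finite (𝓞 E ⧸ I)ˣ := inferInstance
  have hmem : ∀ x : (𝓞 E)ˣ, (((x ^ Nat.card (𝓞 E ⧸ I)ˣ : (𝓞 E)ˣ) : 𝓞 E) : E) ∈ R := by
    intro x
    have h1 : Units.map (Ideal.Quotient.mk I : 𝓞 E →* 𝓞 E ⧸ I) (x ^ Nat.card (𝓞 E ⧸ I)ˣ) = 1 := by
      rw [map_pow, pow_card_eq_one']
    have h2 : Ideal.Quotient.mk I ((x ^ Nat.card (𝓞 E ⧸ I)ˣ : (𝓞 E)ˣ) : 𝓞 E)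
        = Ideal.Quotient.mk I 1 := congrArg Units.val h1
    obtain ⟨y, hy⟩ := Ideal.mem_span_singleton.1 (Ideal.Quotient.eq.1 h2)
    have h3 : (((x ^ Nat.card (𝓞 E ⧸ I)ˣ : (𝓞 E)ˣ) : 𝓞 E) : E) = 1 + (n : E) * y := by
      rw [sub_eq_iff_eq_add] at hy
      rw [hy]
      change algebraMap (𝓞 E) E (n * y + 1) = _
      rw [map_add, map_mul, map_one, map_intCast, add_comm]
    rw [h3]
    exact R.add_mem R.one_mem (hnR y)
  refine ⟨Nat.card (𝓞 E ⧸ I)ˣ, Nat.card_pos, fun x => ⟨⟨⟨_, hmem x⟩, ⟨_, hmem x⁻¹⟩, ?_, ?_⟩, ?_⟩⟩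
  · apply Subtype.ext
    change (((x ^ _ : (𝓞 E)ˣ) : 𝓞 E) : E) * (((x⁻¹ ^ _ : (𝓞 E)ˣ) : 𝓞 E) : E) = 1
    rw [← map_mul, ← Units.val_mul, inv_pow, mul_inv_cancel, Units.val_one, map_one]
  · apply Subtype.ext
    change (((x⁻¹ ^ _ : (𝓞 E)ˣ) : 𝓞 E) : E) * (((x ^ _ : (𝓞 E)ˣ) : 𝓞 E) : E) = 1
    rw [← map_mul, ← Units.val_mul, inv_pow, inv_mul_cancel, Units.val_one, map_one]
  · exact Units.ext (RingOfIntegers.ext rfl)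

/-- Dirichlet's unit theorem for an order in a number field without roots of unity other than `±1`:
modulo torsion, the units of the order are a subgroup of finite index in those of the ring of
integers, so they have the same rank. -/
theorem nonempty_units_order_equiv (hint : ∀ x ∈ R, IsIntegral ℤ x)
    (hQ : ∀ x : E, ∃ n : ℤ, n ≠ 0 ∧ (n : E) * x ∈ R)
    (htors : ∀ (ζ : E) (n : ℕ), 0 < n → ζ ^ n = 1 → ζ = 1 ∨ ζ = -1) :
    Nonempty (Rˣ ≃* ℤˣ × Multiplicative (Fin (Units.rank E) → ℤ)) := by
  let L : Additive (𝓞 E)ˣ →ₗ[ℤ] (Fin (Units.rank E) → ℤ) :=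
    (Units.basisUnitLattice E).equivFun.toLinearMap ∘ₗ
      (Units.logEmbedding E).toIntLinearMap.codRestrict (Units.unitLattice E)
        (fun x => ⟨x, trivial, rfl⟩)
  have hLsurj : Function.Surjective L :=
    (Units.basisUnitLattice E).equivFun.surjective.comp fun y => by
      obtain ⟨y, x, -, rfl⟩ := y
      exact ⟨x, rfl⟩
  have hLker : ∀ x : (𝓞 E)ˣ, L (Additive.ofMul x) = 0 → x ∈ Units.torsion E := by
    intro x hx
    have h1 := (Units.basisUnitLattice E).equivFun.map_eq_zero_iff.1 hx
    exact Units.dirichletUnitTheorem.logEmbedding_eq_zero_iff.1 (congrArg Subtype.val h1)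
  let f : Additive Rˣ →ₗ[ℤ] (Fin (Units.rank E) → ℤ) :=
    L ∘ₗ (MonoidHom.toAdditive (orderUnits hint)).toIntLinearMap
  have hfker : ∀ x : Rˣ, f (Additive.ofMul x) = 0 → x = 1 ∨ x = -1 := by
    intro x hx
    have h1 := hLker _ hx
    obtain ⟨n, hn, h2 : orderUnits hint x ^ n = 1⟩ := isOfFinOrder_iff_pow_eq_one.1 ((CommGroup.mem_torsion _).1 h1)
    have h3 : ((x : R) : E) ^ n = 1 := by
      have h4 : algebraMap (𝓞 E) E ((orderUnits hint x ^ n : (𝓞 E)ˣ) : 𝓞 E) = 1 := by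
        rw [h2, Units.val_one, map_one]
      rw [Units.val_pow_eq_pow_val, map_pow] at h4
      exact h4
    rcases htors _ n hn h3 with h | h
    · exact Or.inl (Units.ext (Subtype.ext h))
    · exact Or.inr (Units.ext (Subtype.ext h))
  obtain ⟨m, hm, hpow⟩ := exists_pow_mem_range_orderUnits hint hQ
  have hrank : Module.finrank ℤ (LinearMap.range f) = Units.rank E := by
    apply le_antisymm
    · simpa using Submodule.finrank_le (LinearMap.range f)
    · have hmul : ∀ t, (m : ℤ) • t ∈ LinearMap.range f := by
        intro t
        obtain ⟨x, rfl⟩ := hLsurj t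
        obtain ⟨y, hy⟩ := hpow x.toMul
        refine ⟨Additive.ofMul y, ?_⟩
        change L (Additive.ofMul (orderUnits hint y)) = _
        rw [hy, ofMul_pow, ofMul_toMul, map_nsmul, natCast_zsmul]
      let M : (Fin (Units.rank E) → ℤ) →ₗ[ℤ] LinearMap.range f :=
        LinearMap.codRestrict _ ((m : ℤ) • LinearMap.id) hmul
      have hM : Function.Injective M := fun s t h => by
        have h1 : (m : ℤ) • s = (m : ℤ) • t := congrArg Subtype.val h
        exact smul_right_injective _ (by exact_mod_cast hm.ne') h1
      simpa using LinearMap.finrank_le_finrank_of_injective hM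
  let e : LinearMap.range f ≃ₗ[ℤ] (Fin (Units.rank E) → ℤ) :=
    LinearEquiv.ofFinrankEq _ _ (by rw [hrank]; simp)
  let f' : Additive Rˣ →ₗ[ℤ] (Fin (Units.rank E) → ℤ) := e.toLinearMap ∘ₗ f.rangeRestrict
  have hf'surj : Function.Surjective f' := e.surjective.comp f.surjective_rangeRestrict
  have hf'ker : ∀ x : Rˣ, f' (Additive.ofMul x) = 0 → x = 1 ∨ x = -1 := fun x hx =>
    hfker x (congrArg Subtype.val (e.map_eq_zero_iff.1 hx))
  -- the free quotient splits off
  obtain ⟨s, hs⟩ := Module.projective_lifting_property f' LinearMap.id hf'surj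
  have hs' : ∀ t, f' (s t) = t := LinearMap.congr_fun hs
  let P : ℤˣ →* Rˣ := Units.map (Int.castRingHom R : ℤ →* R)
  have hP : ∀ ε, f' (Additive.ofMul (P ε)) = 0 := by
    intro ε
    have h1 : (2 : ℤ) • f' (Additive.ofMul (P ε)) = 0 := by
      rw [← map_zsmul, ← ofMul_zpow, ← map_zpow]
      have : ε ^ (2 : ℤ) = 1 := by
        rcases Int.units_eq_one_or ε with h | h <;> rw [h] <;> rfl
      rw [this, map_one, ofMul_one, map_zero]
    exact (smul_eq_zero.1 h1).resolve_left (by norm_num)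
  let Q : Multiplicative (Fin (Units.rank E) → ℤ) →* Rˣ :=
    { toFun := fun t => (s t.toAdd).toMul
      map_one' := by rw [toAdd_one, map_zero]; rfl
      map_mul' := fun a b => by rw [toAdd_mul, map_add]; rfl }
  have hQ' : ∀ t, f' (Additive.ofMul (Q t)) = t.toAdd := fun t => hs' _
  refine ⟨(MulEquiv.ofBijective (P.coprod Q) ⟨?_, ?_⟩).symm⟩
  · refine (injective_iff_map_eq_one _).2 ?_
    rintro ⟨ε, t⟩ h
    rw [MonoidHom.coprod_apply] at h
    have h1 : f' (Additive.ofMul (P ε * Q t)) = 0 := by rw [h, ofMul_one, map_zero]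
    rw [ofMul_mul, map_add, hP, zero_add, hQ'] at h1
    have ht : t = 1 := h1
    rw [ht, map_one, mul_one] at h
    have hε : ε = 1 := by
      have h2 := congrArg (fun x : Rˣ => ((x : R) : E)) h
      have h3 : ((ε : ℤ) : E) = 1 := by simpa [P] using h2
      exact Units.ext (Int.cast_injective (α := E) (by rw [h3]; simp))
    rw [hε, ht]
    rfl
  · intro x
    set t : Multiplicative (Fin (Units.rank E) → ℤ) := Multiplicative.ofAdd (f' (Additive.ofMul x))
    have h1 : f' (Additive.ofMul (x * (Q t)⁻¹)) = 0 := by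
      rw [ofMul_mul, ofMul_inv, map_add, map_neg, hQ', toAdd_ofAdd, add_neg_cancel]
    rcases hf'ker _ h1 with h | h
    · refine ⟨(1, t), ?_⟩
      rw [MonoidHom.coprod_apply, map_one, one_mul]
      exact (mul_inv_eq_one.1 h).symm
    · refine ⟨(-1, t), ?_⟩
      have hP1 : P (-1) = -1 := Units.ext (by simp [P])
      rw [MonoidHom.coprod_apply, hP1, ← h, inv_mul_cancel_right]

end Units

/-! ### `End(T)` as an order -/

section Order

variable {V : Type u} [NormedAddCommGroup V] [NormedSpace ℂ V]
  {Λ : Submodule ℤ V}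

/-- The action of linear maps preserving the lattice on the lattice itself. -/
def latEndRestrict (Λ : Submodule ℤ V) : latEnd Λ →+* Module.End ℤ Λ where
  toFun f := ((f : Module.End ℂ V).restrictScalars ℤ).restrict f.2
  map_one' := rfl
  map_mul' _ _ := rfl
  map_zero' := rfl
  map_add' _ _ := rfl

variable [FiniteDimensional ℂ V] [DiscreteTopology Λ] [IsZLattice ℝ Λ]

/-- Endomorphisms of `T` are integral, because they act faithfully on the finitely generated group
`Λ`. -/
lemma isIntegral_endT (a : EndT Λ) : IsIntegral ℤ a := by
  have hinj : Function.Injective (latEndRestrict Λ) := by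
    refine (injective_iff_map_eq_zero _).2 fun f hf => Subtype.ext ?_
    have h0 : (f : Module.End ℂ V).restrictScalars ℝ = 0 := by
      refine (latBasis Λ).ext fun i => ?_
      exact congrArg Subtype.val (LinearMap.congr_fun hf ⟨_, latBasis_mem Λ i⟩)
    exact LinearMap.ext fun x => LinearMap.congr_fun h0 x
  let F : EndT Λ →ₐ[ℤ] Module.End ℤ Λ :=
    ((latEndRestrict Λ).comp (endTEquiv Λ).toRingHom).toIntAlgHom
  have hF : Function.Injective F := hinj.comp (endTEquiv Λ).injective
  have : Module.Finite ℤ Λ := ZLattice.module_finite ℝ Λ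
  exact (isIntegral_algHom_iff F hF).1 (Module.End.isIntegral.isIntegral _)

variable {E : Type u} [Field E] [NumberField E]

/-- The embedding of `End(T)` into a field isomorphic to `End⁰(T)`. -/
def endTHom (e : End0 Λ ≃+* E) : EndT Λ →+* E :=
  e.toRingHom.comp (Algebra.TensorProduct.includeRight (R := ℤ) (A := ℚ) (B := EndT Λ)).toRingHom

omit [FiniteDimensional ℂ V] [DiscreteTopology Λ] [IsZLattice ℝ Λ] [NumberField E] in
lemma endTHom_apply (e : End0 Λ ≃+* E) (a : EndT Λ) : endTHom e a = e (1 ⊗ₜ a) := rfl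

omit [NumberField E] in
lemma endTHom_injective (e : End0 Λ ≃+* E) : Function.Injective (endTHom e) := by
  intro a b h
  have h1 := e.injective h
  have h2 : (1 : ℚ) ⊗ₜ[ℤ] a = (1 : ℚ) ⊗ₜ[ℤ] b := h1
  apply (endTEquiv Λ).injective
  apply Subtype.ext
  rw [← end0Equiv_one_tmul, h2, end0Equiv_one_tmul]

omit [FiniteDimensional ℂ V] [DiscreteTopology Λ] [IsZLattice ℝ Λ] [NumberField E] in
lemma exists_mul_eq_endTHom (e : End0 Λ ≃+* E) (x : E) :
    ∃ n : ℤ, n ≠ 0 ∧ ∃ a, endTHom e a = n * x := by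
  obtain ⟨n, a, hn, h⟩ := exists_eq_inv_tmul (e.symm x)
  refine ⟨n, hn, a, ?_⟩
  have hn' : (n : ℚ) ≠ 0 := by exact_mod_cast hn
  have hx : x = e ((n : ℚ)⁻¹ ⊗ₜ a) := by rw [← h, RingEquiv.apply_symm_apply]
  rw [hx, ← zsmul_eq_mul, ← map_zsmul, TensorProduct.smul_tmul', zsmul_eq_mul,
    mul_inv_cancel₀ hn', endTHom_apply]

/-- `Aut(T)` is the unit group of an order in `End⁰(T)`. -/
lemma nonempty_autT_equiv {g : ℕ} (hdegs : HasSubfieldDegrees E g) (hg : 3 ≤ g)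
    (e : End0 Λ ≃+* E) :
    Nonempty (AutT Λ ≃* ℤˣ × Multiplicative (Fin (NumberField.Units.rank E) → ℤ)) := by
  obtain ⟨f⟩ := nonempty_units_order_equiv (R := (endTHom e).range)
    (by rintro _ ⟨a, rfl⟩; exact (isIntegral_endT a).map (endTHom e).toIntAlgHom)
    (fun x => by
      obtain ⟨n, hn, a, ha⟩ := exists_mul_eq_endTHom e x
      exact ⟨n, hn, a, ha⟩)
    (fun ζ n hn h => hdegs.root_of_unity hg hn h)
  let r : EndT Λ ≃+* (endTHom e).range := RingEquiv.ofBijective (endTHom e).rangeRestrict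
    ⟨fun a b h => endTHom_injective e (congrArg Subtype.val h),
      (endTHom e).rangeRestrict_surjective⟩
  exact ⟨(Units.mapEquiv r.toMulEquiv).trans f⟩

/-- If `End⁰(T) = ℚ`, then `End(T)` consists of integral rational numbers. -/
lemma bijective_of_finrank_eq_one (e : End0 Λ ≃+* E) (h1 : Module.finrank ℚ E = 1) :
    Function.Bijective (algebraMap ℚ (End0 Λ)) ∧
      Function.Bijective (Int.castRingHom (EndT Λ)) ∧ (Set.univ : Set (AutT Λ)) = {1, -1} := by
  have hE : Function.Surjective (algebraMap ℚ E) := fun x => by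
    obtain ⟨q, hq⟩ := (finrank_eq_one_iff_of_nonzero' (1 : E) one_ne_zero).1 h1 x
    exact ⟨q, by rw [Algebra.algebraMap_eq_smul_one, hq]⟩
  have hcomp : e.toRingHom.comp (algebraMap ℚ (End0 Λ)) = algebraMap ℚ E := Subsingleton.elim _ _
  have hcomp' : ∀ q, e (algebraMap ℚ (End0 Λ) q) = algebraMap ℚ E q := fun q =>
    congrArg (fun f : ℚ →+* E => f q) hcomp
  have hint : Function.Bijective (Int.castRingHom (EndT Λ)) := by
    constructor
    · intro m n h
      have h2 := congrArg (endTHom e) h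
      simp only [eq_intCast, map_intCast] at h2
      exact_mod_cast h2
    · intro a
      obtain ⟨q, hq⟩ := hE (endTHom e a)
      have h2 : IsIntegral ℤ (algebraMap ℚ E q) := by
        rw [hq]
        exact (isIntegral_endT a).map (endTHom e).toIntAlgHom
      obtain ⟨n, hn⟩ := IsIntegrallyClosed.isIntegral_iff.1
        ((isIntegral_algebraMap_iff (algebraMap ℚ E).injective).1 h2)
      refine ⟨n, endTHom_injective e ?_⟩
      rw [← hq, ← hn]
      simp
  refine ⟨⟨fun p q h => ?_, fun t => ?_⟩, hint, ?_⟩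
  · apply (algebraMap ℚ E).injective
    rw [← hcomp', ← hcomp', h]
  · obtain ⟨q, hq⟩ := hE (e t)
    exact ⟨q, e.injective (by rw [hcomp', hq])⟩
  · refine (Set.eq_univ_of_forall fun x => ?_).symm
    let r := RingEquiv.ofBijective _ hint
    rcases Int.units_eq_one_or (Units.map (r.symm : EndT Λ →* ℤ) x) with h | h
    · left
      have h3 : r.symm (x : EndT Λ) = 1 := congrArg Units.val h
      refine Units.ext (r.symm.injective ?_)
      rw [h3, Units.val_one, map_one]
    · right
      have h3 : r.symm (x : EndT Λ) = -1 := congrArg Units.val h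
      refine Units.ext (r.symm.injective ?_)
      rw [h3, Units.val_neg, Units.val_one, map_neg, map_one]

end Order

end ComplexTorus

theorem mainTheorem1 {V : Type u} [NormedAddCommGroup V] [NormedSpace ℂ V] [FiniteDimensional ℂ V]
    (Λ : Submodule ℤ V) [DiscreteTopology Λ] [IsZLattice ℝ Λ]
    (g : ℕ) (hg : Module.finrank ℂ V = g) (hg3 : 3 ≤ g)
    (hT : ComplexTorus.IsTwoSimple Λ) :
    -- (i)
    ComplexTorus.IsSimple Λ ∧
    -- (ii) every field that embeds into the endomorphism algebra
    (∀ (K : Type v) [Field K] (φ : K →ₙ+* ComplexTorus.End0 Λ), Function.Injective φ →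
      ∃ _ : NumberField K, Module.finrank ℚ K = 1 ∨ Module.finrank ℚ K = g ∨
        Module.finrank ℚ K = 2 * g) ∧
    -- (iii) the endomorphism algebra is (isomorphic to) a number field `E`
    ∃ (E : Type u) (_ : Field E) (_ : NumberField E),
      Nonempty (ComplexTorus.End0 Λ ≃+* E) ∧
      (Module.finrank ℚ E = 1 ∨ Module.finrank ℚ E = g ∨ Module.finrank ℚ E = 2 * g) ∧
      -- (iv)
      (Module.finrank ℚ E = 1 →
        Function.Bijective (algebraMap ℚ (ComplexTorus.End0 Λ)) ∧
        Function.Bijective (Int.castRingHom (ComplexTorus.EndT Λ)) ∧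
        (Set.univ : Set (ComplexTorus.AutT Λ)) = {1, -1}) ∧
      -- (v)
      (Module.finrank ℚ E = 2 * g →
        NumberField.IsTotallyComplex E ∧
        Nonempty (ComplexTorus.AutT Λ ≃* ℤˣ × Multiplicative (Fin (g - 1) → ℤ)) ∧
        (¬ ComplexTorus.IsPrimitiveField E →
          ∃ F : IntermediateField ℚ E, F ≠ ⊥ ∧ F ≠ ⊤ ∧ Module.finrank ℚ F = g ∧
            ∀ F' : IntermediateField ℚ E, F' ≠ ⊥ → F' ≠ ⊤ → F' = F)) ∧
      -- (vi)
      (Module.finrank ℚ E = g →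
        ComplexTorus.IsPrimitiveField E ∧
        ∃ d : ℕ, 0 < d ∧
          (d : ℤ) = (NumberField.InfinitePlace.nrRealPlaces E : ℤ) +
            (NumberField.InfinitePlace.nrComplexPlaces E : ℤ) - 1 ∧
          Nonempty (ComplexTorus.AutT Λ ≃* Multiplicative (Fin d → ℤ) × ℤˣ) ∧
          (1 / 2 : ℝ) ≤ (g : ℝ) / 2 - 1 ∧ (g : ℝ) / 2 - 1 ≤ (d : ℝ) ∧ (d : ℝ) ≤ (g : ℝ) - 1 ∧
          (ComplexTorus.IsAbelianVariety Λ →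
            NumberField.IsTotallyReal E ∧ (d : ℤ) = (g : ℤ) - 1)) := by
  have hg3' : 3 ≤ Module.finrank ℂ V := by omega
  obtain ⟨E, _, _, ⟨e⟩⟩ := ComplexTorus.exists_numberField hT hg3'
  let e0 : ComplexTorus.End0 Λ ≃+* E := (ComplexTorus.end0Equiv Λ).trans e
  let j : E →+* Module.End ℂ V := (ComplexTorus.ratEnd Λ).subtype.comp e.symm.toRingHom
  have hj : ∀ k, j k ∈ ComplexTorus.ratEnd Λ := fun k => (e.symm k).2
  have hdegs : ComplexTorus.HasSubfieldDegrees E g := fun K _ _ i => by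
    rw [← hg]
    exact (ComplexTorus.finrank_and_embedding (j := j.comp i) hT hg3' fun k => hj _).1
  have hrank : NumberField.Units.rank E + 1 = NumberField.InfinitePlace.nrRealPlaces E +
      NumberField.InfinitePlace.nrComplexPlaces E := by
    rw [← NumberField.InfinitePlace.card_eq_nrRealPlaces_add_nrComplexPlaces,
      NumberField.Units.rank]
    have : 0 < Fintype.card (NumberField.InfinitePlace E) := Fintype.card_pos
    omega
  have hplaces := NumberField.InfinitePlace.card_add_two_mul_card_eq_rank E
  refine ⟨hT.isSimple hg3', ?_, E, inferInstance, inferInstance, ⟨e0⟩,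
    hdegs E (RingHom.id E), ComplexTorus.bijective_of_finrank_eq_one e0, ?_, ?_⟩
  · intro K _ φ hφ
    -- `φ 1` is a nonzero idempotent of a field
    have hone : e0 (φ 1) = 1 := by
      have h1 : e0 (φ 1) * e0 (φ 1) = e0 (φ 1) := by rw [← map_mul, ← map_mul, one_mul]
      have h2 : e0 (φ 1) ≠ 0 := fun h => one_ne_zero (hφ ((e0.map_eq_zero_iff.1 h).trans
        (map_zero φ).symm))
      exact mul_left_cancel₀ h2 (by rw [h1, mul_one])
    let ψ : K →+* E :=
      { toFun := fun k => e0 (φ k)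
        map_one' := hone
        map_zero' := by rw [map_zero, map_zero]
        map_add' := fun a b => by rw [map_add, map_add]
        map_mul' := fun a b => by rw [map_mul, map_mul] }
    have hchar : CharZero K := (RingHom.charZero_iff ψ.injective).2 inferInstance
    have hfin : FiniteDimensional ℚ K :=
      Module.Finite.of_injective ψ.toRatAlgHom.toLinearMap ψ.injective
    have hK : NumberField K := ⟨⟩
    refine ⟨hK, ?_⟩
    rw [← hg]
    exact (ComplexTorus.finrank_and_embedding (j := j.comp ψ) hT hg3' fun k => hj _).1
  · intro hdeg
    have : Nontrivial V := Module.nontrivial_of_finrank_pos (R := ℂ) (by omega)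
    have hempty := ComplexTorus.isEmpty_real_embedding (j := j) hj (by rw [hdeg, hg])
    have hcomplex : NumberField.IsTotallyComplex E := ⟨fun w => by
      rw [← NumberField.InfinitePlace.not_isReal_iff_isComplex]
      exact fun hw => hempty.false (NumberField.InfinitePlace.embedding_of_isReal hw)⟩
    refine ⟨hcomplex, ?_, hdegs.exists_unique_subfield hg3 hdeg⟩
    have hr := NumberField.nrRealPlaces_eq_zero_iff.2 hcomplex
    have hrk : NumberField.Units.rank E = g - 1 := by omega
    exact hrk ▸ ComplexTorus.nonempty_autT_equiv hdegs hg3 e0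
  · intro hdeg
    refine ⟨hdegs.isPrimitiveField hg3 hdeg, NumberField.Units.rank E, by omega, by omega, ?_, ?_,
      ?_, ?_, fun hab => ?_⟩
    · obtain ⟨f⟩ := ComplexTorus.nonempty_autT_equiv hdegs hg3 e0
      exact ⟨f.trans MulEquiv.prodComm⟩
    · have : (3 : ℝ) ≤ g := by exact_mod_cast hg3
      linarith
    · have : g ≤ 2 * NumberField.Units.rank E + 2 := by omega
      have : (g : ℝ) ≤ 2 * NumberField.Units.rank E + 2 := by exact_mod_cast this
      linarith
    · have : NumberField.Units.rank E + 1 ≤ g := by omega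
      have : (NumberField.Units.rank E : ℝ) + 1 ≤ g := by exact_mod_cast this
      linarith
    · have hreal := ComplexTorus.isTotallyReal_of_isAbelianVariety hT hg3' hab e (by rw [hdeg, hg])
      have hc := NumberField.nrComplexPlaces_eq_zero_iff.2 hreal
      exact ⟨hreal, by omega⟩
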